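/- Let $n$ be a fixed natural number and let $(T_n,+,\cdot)$ be the semiring of all upper triangular $n\times n$-matrices over the two-element Boolean semiring $(\{0,1\},\vee,\wedge)$, under the usual addition and multiplication of matrices. A semiring polynomial is a finite nonempty set $\mathbf W=\mathbf w_1+\dots+\mathbf w_p$ of nonempty words over the variables $x_0,x_1,x_2,\dots$; its value under a substitution $\varphi$ of elements of $T_n$ for the variables is the sum $\mathbf w_1\varphi+\dots+\mathbf w_p\varphi$ of the values of its words. An identity $\mathbf W\approx\mathbf W'$ between two polynomials holds in $(T_n,+,\cdot)$ if $\mathbf W\varphi=\mathbf W'\varphi$ for every substitution $\varphi$. The size of an identity $\mathbf w_1+\dots+\mathbf w_p\approx\mathbf w'_1+\dots+\mathbf w'_{p'}$ is $\sum_{i=1}^p|\mathbf w_i|+\sum_{i=1}^{p'}|\mathbf w'_i|$, the total length of its words. For input to a machine, an identity is written over a finite alphabet, as the sequence of its words, with the variable $x_i$ written as the number $i$ in binary. For every $n$ there is a polynomial-time algorithm that decides whether a given semiring identity holds in $(T_n,+,\cdot)$. Precisely, there are a Turing machine (with finitely many stacks) and polynomials $p,q$, all depending only on $n$, such that for every identity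 the machine halts with the correct answer (YES if the identity holds in $(T_n,+,\cdot)$, NO otherwise) after at most $p(\ell)$ steps, where $\ell$ is the length of the input string, and after at most $q(m)$ steps, where $m$ is the size of the identity, whenever its variables are among $x_0,\dots,x_{m-1}$ (every identity becomes of this form by renaming its variables). -/

import Mathlib

namespace CheckId

/-! ### The ai-semiring of upper triangular Boolean matrices -/

/-- The two-element Boolean semiring `{0, 1}`, with disjunction as addition and conjunction as
multiplication. (The ring structure that Mathlib puts on `Bool` has exclusive or as addition,
hence the type synonym.) -/
def BoolSR : Type := Bool

namespace BoolSR

instance : DecidableEq BoolSR := inferInstanceAs (DecidableEq Bool)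

instance : Fintype BoolSR := inferInstanceAs (Fintype Bool)

instance : Zero BoolSR := ⟨false⟩

instance : One BoolSR := ⟨true⟩

instance : Add BoolSR := ⟨Bool.or⟩

instance : Mul BoolSR := ⟨Bool.and⟩

instance : CommSemiring BoolSR where
  nsmul := nsmulRec
  npow := npowRec
  add_assoc := by decide
  zero_add := by decide
  add_zero := by decide
  add_comm := by decide
  mul_assoc := by decide
  one_mul := by decide
  mul_one := by decide
  mul_comm := by decide
  left_distrib := by decide
  right_distrib := by decide
  zero_mul := by decide
  mul_zero := by decide

theorem add_self : ∀ a : BoolSR, a + a = a := by decide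

end BoolSR

/-- The semiring `(T_n, +, ·)` of all upper triangular Boolean `n × n`-matrices, under the usual
matrix addition and multiplication. -/
def T (n : ℕ) : Subsemiring (Matrix (Fin n) (Fin n) BoolSR) where
  carrier := {A | A.IsUpperTriangular}
  mul_mem' hA hB := Matrix.BlockTriangular.mul hA hB
  one_mem' := Matrix.blockTriangular_one
  add_mem' hA hB := Matrix.BlockTriangular.add hA hB
  zero_mem' := Matrix.blockTriangular_zero

/-! ### Semiring identities -/

/-- A semigroup word: a finite nonempty sequence of variables `x₀, x₁, x₂, …`; the variable `xᵢ`
is represented by its number `i`. -/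
abbrev Word : Type := FreeSemigroup ℕ

/-- The sequence of the variables of a word. -/
def Word.letters (w : Word) : List ℕ := w.head :: w.tail

/-- A semiring polynomial: a finite nonempty set of semigroup words. -/
abbrev Poly : Type := {W : Finset Word // W.Nonempty}

/-- The value of a polynomial under a substitution: the sum of the values of its words. -/
def Poly.value {S : Type} [NonUnitalSemiring S] (φ : ℕ → S) (W : Poly) : S :=
  ∑ w ∈ W.1, FreeSemigroup.lift φ w

/-- The identity `W ≈ W'` holds in `S`. -/
def Holds (S : Type) [NonUnitalSemiring S] (W W' : Poly) : Prop :=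
  ∀ φ : ℕ → S, W.value φ = W'.value φ

/-! ### Instances of the identity checking problem -/

/-- A semiring identity written down as `w₁ + ⋯ + wₚ ≈ w'₁ + ⋯ + w'ₚ'`, with `p, p' ≥ 1`. -/
structure Instance where
  /-- the words `w₁, …, wₚ` -/
  lhs : List Word
  /-- the words `w'₁, …, w'ₚ'` -/
  rhs : List Word
  lhs_ne : lhs ≠ []
  rhs_ne : rhs ≠ []

namespace Instance

/-- The polynomial `{w₁, …, wₚ}`. -/
def left (E : Instance) : Poly :=
  ⟨E.lhs.toFinset, List.toFinset_nonempty_iff _ |>.2 E.lhs_ne⟩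

/-- The polynomial `{w'₁, …, w'ₚ'}`. -/
def right (E : Instance) : Poly :=
  ⟨E.rhs.toFinset, List.toFinset_nonempty_iff _ |>.2 E.rhs_ne⟩

/-- The size of an instance: the total length of all its words. -/
def size (E : Instance) : ℕ :=
  (E.lhs.map FreeSemigroup.length).sum + (E.rhs.map FreeSemigroup.length).sum

/-- The variable `xᵢ` occurs in the instance. -/
def Occurs (E : Instance) (i : ℕ) : Prop :=
  ∃ w ∈ E.lhs ++ E.rhs, i ∈ Word.letters w

end Instance

/-! ### Writing an instance over a finite alphabet -/

/-- The input alphabet: the two binary digits, a mark that ends a variable, a mark that ends a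
word, and a mark that ends a side of the identity. -/
inductive Sym : Type
  | zero
  | one
  | endVar
  | endWord
  | endSide
  deriving DecidableEq

instance : Fintype Sym where
  elems := {Sym.zero, Sym.one, Sym.endVar, Sym.endWord, Sym.endSide}
  complete := by
    intro x
    cases x <;> decide

/-- A variable is written as the binary notation of its number, least significant digit first. -/
def writeVar (i : ℕ) : List Sym :=
  (Nat.bits i).map (fun b => if b then Sym.one else Sym.zero) ++ [Sym.endVar]

def writeWord (w : Word) : List Sym :=
  (Word.letters w).flatMap writeVar ++ [Sym.endWord]

def writeSide (L : List Word) : List Sym :=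
  L.flatMap writeWord ++ [Sym.endSide]

/-- The input string that represents an instance. -/
def Instance.write (E : Instance) : List Sym :=
  writeSide E.lhs ++ writeSide E.rhs

/-! ### Machines -/

/-- A multi-stack Turing machine `M`, started on the input string `s`, halts after at most `t`
steps with the one-symbol output `b` (`true` for YES and `false` for NO). -/
def AnswersWithin (M : Turing.TM2ComputableAux Sym Bool) (s : List Sym) (b : Bool) (t : ℕ) :
    Prop :=
  Nonempty (Turing.TM2OutputsInTime M.tm (s.map M.inputAlphabet.symm)
    (some ([b].map M.outputAlphabet.symm)) t)

/-- The correct answer to the instance `E` of the identity checking problem of `(T_n, +, ·)`. -/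
noncomputable def answer (n : ℕ) (E : Instance) : Bool :=
  @decide (Holds (T n) E.left E.right) (Classical.propDecidable _)

end CheckId

/-! A substitution into `T n` is a family of graphs on `n` linearly ordered vertices, one for each
variable, in which no edge goes down. An entry of the value of a word is 1 exactly if the word
labels a path between the two vertices (`lift_apply_eq_one`). As Boolean sums are disjunctions, an
identity holds iff in all such families every path labelled by a word of one side can be replaced by
a path with the same ends that is labelled by a word of the other side (`holds_iff`).

To test this it suffices to keep only the edges of the given path. For `n = m + 1`, a path is
described by `m` cuts of its word: cut `a` sits at the letter whose edge leads from a vertex `≤ a`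
to a vertex `> a`, or at the beginning or the end of the word if no edge does so. Another word has a
path with the same ends along the same edges iff it can be cut in such a way that each of its
letters has a counterpart in the first word, with the same variable and the same position relative
to all cuts. This replaces graphs by cuts and leads to `Included` (`WordAt.cuts_of_path`,
`WordAt.path_of_cuts`, `included_iff`).

Now `Included` is a first-order statement about positions of the input string, and the number of its
quantifiers depends on `n` only. A fixed machine evaluates it by exhaustive search: each variable of
the formula owns two stacks that hold the string before and after its value, a quantifier is a loop
over all positions, and equality of variables of the identity is a comparison of digit strings.
Nesting a fixed number of loops costs polynomial time (`Fml.prog_runs`, `Fml.exists_machine`). The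
search is written as a structured program, which a machine executes in the same number of steps
(`Runs.steps`).

The bound in terms of the size follows because the input is at most quadratically long if the
variables are numbered below the size (`Instance.length_write_le`). -/

namespace CheckId

/-! ### Structured programs for multi-stack machines -/

section Programs

open Turing Function

variable {K : Type} {Γ : K → Type} {σ : Type}

/-- An elementary operation of a multi-stack machine. -/
inductive Op (Γ : K → Type) (σ : Type) : Type
  | push (k : K) (f : σ → Γ k)
  | peek (k : K) (f : σ → Option (Γ k) → σ)
  | pop (k : K) (f : σ → Option (Γ k) → σ)
  | load (f : σ → σ)

/-- The internal state and the contents of the stacks. -/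
abbrev Mem (Γ : K → Type) (σ : Type) : Type := σ × ∀ k, List (Γ k)

/-- The effect of an operation. -/
def Op.run [DecidableEq K] : Op Γ σ → Mem Γ σ → Mem Γ σ
  | push k f, c => (c.1, update c.2 k (f c.1 :: c.2 k))
  | peek k f, c => (f c.1 (c.2 k).head?, c.2)
  | pop k f, c => (f c.1 (c.2 k).head?, update c.2 k (c.2 k).tail)
  | load f, c => (f c.1, c.2)

/-- An operation followed by a statement of the machine. -/
def Op.stmt {Λ : Type} : Op Γ σ → TM2.Stmt Γ Λ σ → TM2.Stmt Γ Λ σ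
  | push k f, q => .push k f q
  | peek k f, q => .peek k f q
  | pop k f, q => .pop k f q
  | load f, q => .load f q

/-- The effect of a list of operations. -/
def runOps [DecidableEq K] (l : List (Op Γ σ)) (c : Mem Γ σ) : Mem Γ σ :=
  l.foldl (fun c o => o.run c) c

@[simp] theorem runOps_nil [DecidableEq K] (c : Mem Γ σ) : runOps [] c = c := rfl

@[simp] theorem runOps_cons [DecidableEq K] (o : Op Γ σ) (l : List (Op Γ σ)) (c : Mem Γ σ) :
    runOps (o :: l) c = runOps l (o.run c) := rfl

theorem runOps_append [DecidableEq K] (l l' : List (Op Γ σ)) (c : Mem Γ σ) :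
    runOps (l ++ l') c = runOps l' (runOps l c) := by
  simp [runOps]

/-- A list of operations followed by a statement of the machine. -/
def stmtOps {Λ : Type} (l : List (Op Γ σ)) (q : TM2.Stmt Γ Λ σ) : TM2.Stmt Γ Λ σ :=
  l.foldr Op.stmt q

/-- A whole statement is executed in a single step of the machine. This is why a list of operations
costs 1 in `Runs`, whatever its length. -/
theorem stepAux_stmtOps [DecidableEq K] {Λ : Type} (l : List (Op Γ σ)) (q : TM2.Stmt Γ Λ σ)
    (c : Mem Γ σ) :
    TM2.stepAux (stmtOps l q) c.1 c.2 = TM2.stepAux q (runOps l c).1 (runOps l c).2 := by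
  induction l generalizing c with
  | nil => rfl
  | cons o l ih =>
    rw [runOps_cons, ← ih]
    cases o <;> rfl

/-- A structured program. The lists of operations in a conditional statement and in a loop are
executed before each evaluation of the condition. -/
inductive Prog (Γ : K → Type) (σ : Type) : Type
  | ops (l : List (Op Γ σ))
  | seq (P Q : Prog Γ σ)
  | ite (p : σ → Bool) (P Q : Prog Γ σ)
  | loop (l : List (Op Γ σ)) (p : σ → Bool) (P : Prog Γ σ)

/-- The program `P` can run from `c` to `c'` in `t` steps. -/
inductive Runs [DecidableEq K] : Prog Γ σ → Mem Γ σ → Mem Γ σ → ℕ → Prop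
  | ops {l} {c c' : Mem Γ σ} : runOps l c = c' → Runs (.ops l) c c' 1
  | seq {P Q c c' c'' t t'} : Runs P c c' t → Runs Q c' c'' t' → Runs (.seq P Q) c c'' (t + t')
  | iteTrue {p : σ → Bool} {P Q c c' t} : p c.1 = true → Runs P c c' t →
      Runs (.ite p P Q) c c' (1 + t)
  | iteFalse {p : σ → Bool} {P Q c c' t} : p c.1 = false → Runs Q c c' t →
      Runs (.ite p P Q) c c' (1 + t)
  | loopDone {l} {p : σ → Bool} {P} {c c' : Mem Γ σ} : runOps l c = c' → p c'.1 = false →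
      Runs (.loop l p P) c c' 1
  | loopStep {l} {p : σ → Bool} {P} {c c' c'' c''' : Mem Γ σ} {t t'} : runOps l c = c' →
      p c'.1 = true → Runs P c' c'' t → Runs (.loop l p P) c'' c''' t' →
      Runs (.loop l p P) c c''' (1 + (t + t'))

/-- The labels of the machine for a program. -/
def Prog.Label : Prog Γ σ → Type
  | ops _ => Unit
  | seq P Q => P.Label ⊕ Q.Label
  | ite _ P Q => Option (P.Label ⊕ Q.Label)
  | loop _ _ P => Option P.Label

instance Prog.fintypeLabel : (P : Prog Γ σ) → Fintype P.Label
  | ops _ => inferInstanceAs (Fintype Unit)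
  | seq P Q =>
    letI := P.fintypeLabel
    letI := Q.fintypeLabel
    inferInstanceAs (Fintype (P.Label ⊕ Q.Label))
  | ite _ P Q =>
    letI := P.fintypeLabel
    letI := Q.fintypeLabel
    inferInstanceAs (Fintype (Option (P.Label ⊕ Q.Label)))
  | loop _ _ P =>
    letI := P.fintypeLabel
    inferInstanceAs (Fintype (Option P.Label))

/-- The label at which the execution of a program starts. -/
def Prog.entry : (P : Prog Γ σ) → P.Label
  | ops _ => ()
  | seq P _ => Sum.inl P.entry
  | ite _ _ _ => none
  | loop _ _ _ => none

/-- The statements of the machine for a program, where the labels of the program are embedded into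
a type `Λ` and `exit` is the label to go to at the end. -/
def Prog.code {Λ : Type} : (P : Prog Γ σ) → (P.Label → Λ) → Λ → P.Label → TM2.Stmt Γ Λ σ
  | ops l, _, exit, _ => stmtOps l (.goto fun _ => exit)
  | seq P Q, emb, exit, x =>
    Sum.rec (fun y => P.code (fun z => emb (Sum.inl z)) (emb (Sum.inr Q.entry)) y)
      (fun y => Q.code (fun z => emb (Sum.inr z)) exit y) x
  | ite p P Q, emb, exit, x =>
    Option.rec (.branch p (.goto fun _ => emb (some (Sum.inl P.entry)))
        (.goto fun _ => emb (some (Sum.inr Q.entry))))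
      (fun y => Sum.rec (fun y => P.code (fun z => emb (some (Sum.inl z))) exit y)
        (fun y => Q.code (fun z => emb (some (Sum.inr z))) exit y) y) x
  | loop l p P, emb, exit, x =>
    Option.rec (stmtOps l (.branch p (.goto fun _ => emb (some P.entry)) (.goto fun _ => exit)))
      (fun y => P.code (fun z => emb (some z)) (emb none) y) x

/-- The machine `M` gets from `a` to `b` in exactly `t` steps. -/
def Steps [DecidableEq K] {Λ : Type} (M : Λ → TM2.Stmt Γ Λ σ) (t : ℕ) (a b : TM2.Cfg Γ Λ σ) :
    Prop :=
  (flip bind (TM2.step M))^[t] (some a) = some b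

theorem Steps.one [DecidableEq K] {Λ : Type} {M : Λ → TM2.Stmt Γ Λ σ} {a b : TM2.Cfg Γ Λ σ}
    (h : TM2.step M a = some b) : Steps M 1 a b := h

theorem Steps.trans [DecidableEq K] {Λ : Type} {M : Λ → TM2.Stmt Γ Λ σ} {t t' : ℕ}
    {a b c : TM2.Cfg Γ Λ σ} (h : Steps M t a b) (h' : Steps M t' b c) : Steps M (t + t') a c := by
  unfold Steps at *
  rw [Nat.add_comm, iterate_add_apply, h, h']

/-- Induction on the run. The embedding of labels and the exit are arbitrary, so that the induction
hypothesis applies to a subprogram inside a larger machine. -/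
theorem Runs.steps [DecidableEq K] {P : Prog Γ σ} {c c' : Mem Γ σ} {t : ℕ} (h : Runs P c c' t)
    {Λ : Type} (M : Λ → TM2.Stmt Γ Λ σ) (emb : P.Label → Λ) (exit : Λ)
    (hM : ∀ x, M (emb x) = P.code emb exit x) :
    Steps M t ⟨some (emb P.entry), c.1, c.2⟩ ⟨some exit, c'.1, c'.2⟩ := by
  induction h generalizing exit with
  | ops hc =>
    apply Steps.one
    simp only [TM2.step, hM, Prog.code, stepAux_stmtOps, TM2.stepAux, hc]
  | @seq P Q _ _ _ _ _ _ _ ih ih' =>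
    exact (ih _ (emb (Sum.inr Q.entry)) fun x => hM (Sum.inl x)).trans
      (ih' (fun x => emb (Sum.inr x)) exit fun x => hM (Sum.inr x))
  | @iteTrue p P Q c _ _ hp _ ih =>
    have h : M (emb none) = .branch p (.goto fun _ => emb (some (Sum.inl P.entry)))
      (.goto fun _ => emb (some (Sum.inr Q.entry))) := hM none
    refine (Steps.one ?_).trans (ih (fun x => emb (some (Sum.inl x))) exit
      fun x => hM (some (Sum.inl x)))
    simp only [TM2.step, Prog.entry, h, TM2.stepAux, hp, cond_true]
  | @iteFalse p P Q c _ _ hp _ ih =>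
    have h : M (emb none) = .branch p (.goto fun _ => emb (some (Sum.inl P.entry)))
      (.goto fun _ => emb (some (Sum.inr Q.entry))) := hM none
    refine (Steps.one ?_).trans (ih (fun x => emb (some (Sum.inr x))) exit
      fun x => hM (some (Sum.inr x)))
    simp only [TM2.step, Prog.entry, h, TM2.stepAux, hp, cond_false]
  | @loopDone l p P c _ hc hp =>
    have h : M (emb none) = stmtOps l (.branch p (.goto fun _ => emb (some P.entry))
      (.goto fun _ => exit)) := hM none
    apply Steps.one
    simp only [TM2.step, Prog.entry, h, stepAux_stmtOps, TM2.stepAux, hc, hp, cond_false]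
  | @loopStep l p P c _ _ _ _ _ hc hp _ _ ih ih' =>
    have h : M (emb none) = stmtOps l (.branch p (.goto fun _ => emb (some P.entry))
      (.goto fun _ => exit)) := hM none
    -- The body of the loop exits to the head `emb none` of the loop, from where the remaining
    -- iterations run.
    refine (Steps.one ?_).trans ((ih (fun x => emb (some x)) (emb none)
      fun x => hM (some x)).trans (ih' emb exit hM))
    simp only [TM2.step, Prog.entry, h, stepAux_stmtOps, TM2.stepAux, hc, hp, cond_true]

end Programs

/-! ### First-order formulas over the positions of a string -/

section Formulas

open Function

/-- Compare two strings from their beginnings on: proceed as long as `cont` holds for the current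
symbols, and return the value of `res` on the symbols where this stops (`none` means the end of a
string). -/
def scan (cont : Sym → Sym → Bool) (res : Option Sym → Option Sym → Bool) :
    List Sym → List Sym → Bool
  | a :: as, b :: bs => if cont a b then scan cont res as bs else res (some a) (some b)
  | [], bs => res none bs.head?
  | as, [] => res as.head? none

/-- First-order formulas over the positions of a string, with variables from `V`. -/
inductive Fml (V : Type) : Type
  | sym (v : V) (f : Sym → Bool)
  | scan (i j : V) (cont : Sym → Sym → Bool) (res : Option Sym → Option Sym → Bool)
  | not (φ : Fml V)
  | and (φ ψ : Fml V)
  | ex (d : V) (φ : Fml V)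

namespace Fml

variable {V : Type} [DecidableEq V]

/-- The truth of a formula in the string `s`. An atomic formula `sym v f` concerns the symbol at
the position `v`, and an atomic formula `scan i j cont res` the symbols before the positions
`i` and `j`, from right to left. -/
def Eval (s : List Sym) : Fml V → (V → ℕ) → Prop
  | sym v f, r => ∃ a ∈ s[r v]?, f a = true
  | scan i j cont res, r =>
    CheckId.scan cont res (s.take (r i)).reverse (s.take (r j)).reverse = true
  | not φ, r => ¬ φ.Eval s r
  | and φ ψ, r => φ.Eval s r ∧ ψ.Eval s r
  | ex d φ, r => ∃ x ≤ s.length, φ.Eval s (update r d x)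

/-- The variable `d` is bound in a formula. -/
def Binds : Fml V → V → Prop
  | sym _ _, _ => False
  | scan _ _ _ _, _ => False
  | not φ, d => φ.Binds d
  | and φ ψ, d => φ.Binds d ∨ ψ.Binds d
  | ex e φ, d => d = e ∨ φ.Binds d

/-- No variable is bound again in the scope of a quantifier that binds it, and the variables in
each comparison are different. -/
def Proper : Fml V → Prop
  | sym _ _ => True
  | scan i j _ _ => i ≠ j
  | not φ => φ.Proper
  | and φ ψ => φ.Proper ∧ ψ.Proper
  | ex d φ => ¬ φ.Binds d ∧ φ.Proper

/-- A bound for the time to evaluate a formula in a string of length `N`. -/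
noncomputable def time (N : Polynomial ℕ) : Fml V → Polynomial ℕ
  | sym _ _ => 1
  | scan _ _ _ _ => 4 * N + 3
  | not φ => φ.time N + 1
  | and φ ψ => φ.time N + ψ.time N + 2
  | ex _ φ => φ.time N + N * (φ.time N + 4) + 2

end Fml

/-! ### Evaluating formulas by a multi-stack machine -/

/-- The stacks of the machine: a stack for the input (and for counting), a stack for the output,
and, for each variable of the formula, two stacks that hold the string before and after the
position that is the value of the variable. -/
inductive Stk (V : Type) : Type
  | inp
  | out
  | left (v : V)
  | right (v : V)
  deriving DecidableEq, Fintype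

/-- The stack alphabets. -/
@[reducible] def Stk.Alphabet {V : Type} : Stk V → Type
  | out => Bool
  | inp => Sym
  | left _ => Sym
  | right _ => Sym

/-- The internal states: a truth value and two buffers for symbols. -/
abbrev St : Type := Bool × Option Sym × Option Sym

variable {V : Type}

/-- The contents of the stacks. -/
def cells (h : V → List Sym × List Sym) (c : List Sym) (o : List Bool) :
    ∀ k : Stk V, List k.Alphabet
  | .inp => c
  | .out => o
  | .left v => (h v).1
  | .right v => (h v).2

variable (h : V → List Sym × List Sym) (c : List Sym) (o : List Bool)

@[simp] theorem cells_inp : cells h c o .inp = c := rfl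

@[simp] theorem cells_out : cells h c o .out = o := rfl

@[simp] theorem cells_left (v : V) : cells h c o (.left v) = (h v).1 := rfl

@[simp] theorem cells_right (v : V) : cells h c o (.right v) = (h v).2 := rfl

variable [DecidableEq V]

@[simp] theorem update_cells_inp (l : List Sym) :
    update (cells h c o) .inp l = cells h l o := by
  funext k
  cases k <;> simp

@[simp] theorem update_cells_out (l : List Bool) :
    update (cells h c o) .out l = cells h c l := by
  funext k
  cases k <;> simp

@[simp] theorem update_cells_left (v : V) (l : List Sym) :
    update (cells h c o) (.left v) l = cells (update h v (l, (h v).2)) c o := by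
  funext k
  cases k with
  | left w => obtain rfl | e := eq_or_ne w v <;> simp [*]
  | right w => obtain rfl | e := eq_or_ne w v <;> simp [*]
  | _ => simp

@[simp] theorem update_cells_right (v : V) (l : List Sym) :
    update (cells h c o) (.right v) l = cells (update h v ((h v).1, l)) c o := by
  funext k
  cases k with
  | left w => obtain rfl | e := eq_or_ne w v <;> simp [*]
  | right w => obtain rfl | e := eq_or_ne w v <;> simp [*]
  | _ => simp

/-- Move the position of a variable by one to the left. -/
def moveLeft (v : V) : List (Op (Stk.Alphabet (V := V)) St) :=
  [.pop (.left v) fun q a => (q.1, a, none), .push (.right v) fun q => q.2.1.getD .zero,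
    .load fun q => (q.1, none, none)]

/-- Move the position of a variable by one to the right. -/
def moveRight (v : V) : List (Op (Stk.Alphabet (V := V)) St) :=
  [.pop (.right v) fun q a => (q.1, a, none), .push (.left v) fun q => q.2.1.getD .zero,
    .load fun q => (q.1, none, none)]

variable {h c o}

theorem runOps_moveLeft {v : V} {a : Sym} {l r : List Sym} (hv : h v = (a :: l, r)) (q : St) :
    runOps (moveLeft v) (q, cells h c o) =
      ((q.1, none, none), cells (update h v (l, a :: r)) c o) := by
  simp [moveLeft, Op.run, hv]

theorem runOps_moveRight {v : V} {a : Sym} {l r : List Sym} (hv : h v = (l, a :: r)) (q : St) :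
    runOps (moveRight v) (q, cells h c o) =
      ((q.1, none, none), cells (update h v (a :: l, r)) c o) := by
  simp [moveRight, Op.run, hv]

/-- The first loop in the evaluation of a comparison. -/
def scanLoop (i j : V) (cont : Sym → Sym → Bool) : Prog (Stk.Alphabet (V := V)) St :=
  .loop [.peek (.left i) fun q a => (q.1, a, q.2.2), .peek (.left j) fun q b => (q.1, q.2.1, b)]
    (fun q => match q.2 with
      | (some a, some b) => cont a b
      | _ => false)
    (.ops (moveLeft i ++ (moveLeft j ++ [.push .inp fun _ => Sym.zero])))

/-- The second loop in the evaluation of a comparison, which restores the positions. -/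
def restoreLoop (i j : V) : Prog (Stk.Alphabet (V := V)) St :=
  .loop [.peek .inp fun q a => (q.1, a, none)] (fun q => q.2.1.isSome)
    (.ops ((Op.pop .inp fun q _ => q) :: (moveRight i ++ moveRight j)))

/-- Each iteration leaves a mark on the stack `.inp`, which tells how many shifts have to be undone.
Restoring is expressed by transfer: a run of `restoreLoop` from the original stacks extends to one
from the stacks left by the scan. Hence those stacks need no description, and each induction step
has to undo one shift only. -/
theorem scanLoop_runs {i j : V} (hij : i ≠ j) (cont : Sym → Sym → Bool)
    (res : Option Sym → Option Sym → Bool) (as : List Sym) : ∀ (bs ra rb c : List Sym)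
    (h : V → List Sym × List Sym) (q : St), h i = (as, ra) → h j = (bs, rb) →
    ∃ (q' : St) (S : ∀ k : Stk V, List k.Alphabet) (t : ℕ), t ≤ 2 * as.length + 1 ∧
      Runs (scanLoop i j cont) (q, cells h c o) (q', S) t ∧
      res q'.2.1 q'.2.2 = scan cont res as bs ∧
      ∀ (f : Bool) (X : Mem (Stk.Alphabet (V := V)) St) (t : ℕ),
        Runs (restoreLoop i j) ((f, none, none), cells h c o) X t →
        ∃ t' ≤ t + 2 * as.length, Runs (restoreLoop i j) ((f, none, none), S) X t' := by
  induction as with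
  | nil =>
    intro bs ra rb c h q hi hj
    refine ⟨_, _, 1, by omega, .loopDone rfl ?_, ?_, fun f X t ht => ⟨t, by omega, ht⟩⟩
    · simp [Op.run, hi]
    · simp [Op.run, hi, hj, scan]
  | cons a as ih =>
    intro bs ra rb c h q hi hj
    cases bs with
    | nil =>
      refine ⟨_, _, 1, by omega, .loopDone rfl ?_, ?_, fun f X t ht => ⟨t, by omega, ht⟩⟩
      · simp [Op.run, hi, hj]
      · simp [Op.run, hi, hj, scan]
    | cons b bs =>
      by_cases hc : cont a b = true
      · set h1 := update h i (as, a :: ra) with hh1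
        set h2 := update h1 j (bs, b :: rb) with hh2
        have h1j : h1 j = (b :: bs, rb) := by rw [hh1, update_of_ne hij.symm, hj]
        have h2i : h2 i = (as, a :: ra) := by rw [hh2, update_of_ne hij, hh1, update_self]
        have h2j : h2 j = (bs, b :: rb) := by rw [hh2, update_self]
        obtain ⟨q', S, t, ht, hrun, hres, hback⟩ :=
          ih bs (a :: ra) (b :: rb) (Sym.zero :: c) h2 (q.1, none, none) h2i h2j
        refine ⟨q', S, 1 + (1 + t), ?_, .loopStep rfl (by simp [Op.run, hi, hj, hc]) (.ops ?_) hrun,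
          ?_, ?_⟩
        · simp only [List.length_cons]; omega
        · rw [runOps_append, runOps_append]
          simp only [runOps_cons, Op.run, runOps_nil]
          rw [runOps_moveLeft hi, runOps_moveLeft h1j]
          simp [hh2]
        · rw [hres, scan, if_pos hc]
        · intro f X t1 ht1
          -- One iteration of the second loop removes a mark and leads from `h2` back to `h`, where
          -- the given run takes over.
          obtain ⟨t', ht', hrun'⟩ := hback f X (1 + (1 + t1)) (by
            refine .loopStep rfl (by simp [Op.run]) (.ops ?_) ht1
            rw [runOps_cons, runOps_append]
            simp only [runOps_cons, Op.run, runOps_nil, cells_inp,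
              update_cells_inp, List.tail_cons]
            rw [runOps_moveRight h2i, runOps_moveRight (a := b) (l := bs) (r := rb)
              (by rw [update_of_ne hij.symm, h2j])]
            congr 2
            funext v
            by_cases hvj : v = j
            · subst hvj; simp [hj]
            · by_cases hvi : v = i
              · subst hvi; simp [hij, hi]
              · simp [hvi, hvj, hh2, hh1])
          exact ⟨t', by simp only [List.length_cons]; omega, hrun'⟩
      · refine ⟨_, _, 1, by omega, .loopDone rfl ?_, ?_, fun f X t ht => ⟨t, by omega, ht⟩⟩
        · simpa [Op.run, hi, hj] using hc
        · simp [Op.run, hi, hj, scan, hc]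

/-- Move the position of a variable to the beginning. -/
def rewind (v : V) : Prog (Stk.Alphabet (V := V)) St :=
  .loop [.peek (.left v) fun q a => (q.1, a, none)] (fun q => q.2.1.isSome) (.ops (moveLeft v))

theorem rewind_runs {v : V} (l : List Sym) : ∀ {r : List Sym} {h : V → List Sym × List Sym},
    h v = (l, r) → ∀ q : St,
    Runs (rewind v) (q, cells h c o)
      ((q.1, none, none), cells (update h v ([], l.reverse ++ r)) c o) (2 * l.length + 1) := by
  induction l with
  | nil =>
    intro r h hv q
    have e : update h v ([], [].reverse ++ r) = h := by
      rw [List.reverse_nil, List.nil_append, ← hv, update_eq_self]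
    rw [e]
    refine .loopDone ?_ rfl
    simp [Op.run, hv]
  | cons a l ih =>
    intro r h hv q
    have := ih (r := a :: r) (h := update h v (l, a :: r)) (by simp) (q.1, none, none)
    rw [List.length_cons, show 2 * (l.length + 1) + 1 = 1 + (1 + (2 * l.length + 1)) by ring]
    refine .loopStep rfl (by simp [Op.run, hv]) (.ops (runOps_moveLeft hv _)) ?_
    rw [update_idem] at this
    rw [List.reverse_cons, List.append_assoc, List.singleton_append]
    exact this

/-- The program that evaluates a formula. -/
def Fml.prog : Fml V → Prog (Stk.Alphabet (V := V)) St
  | sym v f => .ops [.peek (.right v) fun _ a => (a.any f, none, none)]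
  | scan i j cont res =>
    .seq (scanLoop i j cont)
      (.seq (.ops [.load fun q => (res q.2.1 q.2.2, none, none)]) (restoreLoop i j))
  | not φ => .seq φ.prog (.ops [.load fun q => (!q.1, none, none)])
  | and φ ψ => .seq φ.prog (.ite (fun q => q.1) ψ.prog (.ops []))
  | ex d φ =>
    .seq (.seq φ.prog
      (.loop [.peek (.right d) fun q a => (q.1, a, none)] (fun q => !q.1 && q.2.1.isSome)
        (.seq (.ops (moveRight d)) φ.prog)))
      (rewind d)

/-- The contents of the stacks for given values of the variables. -/
def heads (s : List Sym) (r : V → ℕ) (v : V) : List Sym × List Sym :=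
  ((s.take (r v)).reverse, s.drop (r v))

theorem heads_update (s : List Sym) (r : V → ℕ) (v : V) (x : ℕ) :
    heads s (update r v x) = update (heads s r) v ((s.take x).reverse, s.drop x) := by
  funext w
  by_cases e : w = v
  · subst e; simp [heads]
  · simp [heads, e]

open Classical in
-- The evaluation restores all stacks, so that subformulas can be evaluated one after another. A
-- search relies on its variable being at position 0 initially; `Proper` preserves this for nested
-- quantifiers, since a variable that has been moved by a search is not bound again in its scope.
theorem Fml.prog_runs (s : List Sym) {N : Polynomial ℕ} {m : ℕ} (hN : s.length ≤ N.eval m) :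
    ∀ φ : Fml V, φ.Proper → ∀ (r : V → ℕ), (∀ v, r v ≤ s.length) → (∀ d, φ.Binds d → r d = 0) →
      ∀ q : St, ∃ t ≤ (φ.time N).eval m,
        Runs φ.prog (q, cells (heads s r) [] o)
          ((decide (φ.Eval s r), none, none), cells (heads s r) [] o) t := by
  intro φ
  induction φ with
  | sym v f =>
    intro _ r _ _ q
    refine ⟨1, by simp [time], ?_⟩
    refine .ops ?_
    simp only [runOps_cons, Op.run, runOps_nil, cells_right, heads, List.head?_drop]
    congr 2
    rw [Bool.eq_iff_iff, decide_eq_true_iff, Option.any_eq_true]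
    exact ⟨fun ⟨a, ha⟩ => ⟨a, ha⟩, fun ⟨a, ha⟩ => ⟨a, ha⟩⟩
  | scan i j cont res =>
    intro hp r hr _ q
    obtain ⟨q', S, t, ht, h1, h2, h3⟩ := scanLoop_runs (o := o) hp cont res (s.take (r i)).reverse
      (s.take (r j)).reverse (s.drop (r i)) (s.drop (r j)) [] (heads s r) q rfl rfl
    have hlen : (s.take (r i)).reverse.length ≤ N.eval m := by
      have := hr i
      simp only [List.length_reverse, List.length_take]; omega
    -- From the original stacks `restoreLoop` stops at once, as `.inp` is empty.
    obtain ⟨t', ht', h4⟩ := h3 (decide (Eval s (scan i j cont res) r))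
      ((decide (Eval s (scan i j cont res) r), none, none), cells (heads s r) [] o) 1
      (.loopDone (by simp [Op.run]) rfl)
    refine ⟨t + (1 + t'), ?_, .seq h1 (.seq (.ops ?_) h4)⟩
    · simp [time]; omega
    · simp only [runOps_cons, Op.run, runOps_nil, h2]
      congr 2
      rw [Bool.eq_iff_iff, decide_eq_true_iff]
      rfl
  | not φ ih =>
    intro hp r hr hb q
    obtain ⟨t, ht, h1⟩ := ih hp r hr hb q
    refine ⟨t + 1, by simp [time]; omega, .seq h1 (.ops ?_)⟩
    simp only [runOps_cons, Op.run, runOps_nil, Eval]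
    by_cases hφ : φ.Eval s r <;> simp [hφ]
  | and φ ψ ih ih' =>
    intro hp r hr hb q
    obtain ⟨t, ht, h1⟩ := ih hp.1 r hr (fun d hd => hb d (.inl hd)) q
    by_cases hφ : φ.Eval s r
    · obtain ⟨t', ht', h2⟩ := ih' hp.2 r hr (fun d hd => hb d (.inr hd))
        (decide (φ.Eval s r), none, none)
      refine ⟨t + (1 + t'), by simp [time]; omega, .seq h1 (.iteTrue (by simp [hφ]) ?_)⟩
      simpa [Eval, hφ] using h2
    · refine ⟨t + (1 + 1), by simp [time]; omega, .seq h1 (.iteFalse (by simp [hφ]) (.ops ?_))⟩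
      simp [Eval, hφ]
  | ex d φ ih =>
    intro hp r hr hb q
    set T := (φ.time N).eval m with hT
    have hstep (x : ℕ) (hx : x ≤ s.length) (q : St) : ∃ t ≤ T, Runs φ.prog
        (q, cells (heads s (update r d x)) [] o)
        ((decide (φ.Eval s (update r d x)), none, none), cells (heads s (update r d x)) [] o)
        t := by
      refine ih hp.2 (update r d x) (fun v => ?_) (fun e he => ?_) q
      · by_cases hv : v = d
        · subst hv; simpa using hx
        · simpa [hv] using hr v
      · have hed : e ≠ d := by rintro rfl; exact hp.1 he
        rw [update_of_ne hed]
        exact hb e (.inr he)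
    -- The search stops at the first witness or at the end of the string. Started at `x`, it
    -- therefore detects witnesses from `x` on; `n` counts the positions that remain.
    have hloop (n : ℕ) : ∀ x ≤ s.length, s.length - x = n →
        ∃ y ≤ s.length, ∃ (a : Option Sym), ∃ t ≤ n * (T + 2) + 1, Runs
          (.loop [.peek (.right d) fun q a => (q.1, a, none)] (fun q => !q.1 && q.2.1.isSome)
            (.seq (.ops (moveRight d)) φ.prog))
          ((decide (φ.Eval s (update r d x)), none, none),
            cells (heads s (update r d x)) [] o)
          ((decide (∃ z ≤ s.length, x ≤ z ∧ φ.Eval s (update r d z)), a, none),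
            cells (heads s (update r d y)) [] o) t := by
      induction n with
      | zero =>
        intro x hx hn
        obtain rfl : x = s.length := by omega
        refine ⟨_, le_rfl, none, 1, by omega, ?_⟩
        have e : (∃ z ≤ s.length, s.length ≤ z ∧ φ.Eval s (update r d z)) ↔
            φ.Eval s (update r d s.length) :=
          ⟨fun ⟨z, h1, h2, h3⟩ => by rwa [le_antisymm h2 h1], fun h => ⟨_, le_rfl, le_rfl, h⟩⟩
        simp only [e]
        refine .loopDone ?_ (by simp)
        simp [Op.run, heads]
      | succ n ihn =>
        intro x hx hn
        have hxs : x < s.length := by omega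
        by_cases hφ : φ.Eval s (update r d x)
        · have e : ∃ z ≤ s.length, x ≤ z ∧ φ.Eval s (update r d z) := ⟨x, hx, le_rfl, hφ⟩
          simp only [hφ, e, decide_true]
          refine ⟨x, hx, s[x]?, 1, by omega, ?_⟩
          refine .loopDone ?_ (by simp)
          simp [Op.run, heads]
        · have e : (∃ z ≤ s.length, x ≤ z ∧ φ.Eval s (update r d z)) ↔
              ∃ z ≤ s.length, x + 1 ≤ z ∧ φ.Eval s (update r d z) := by
            constructor
            · rintro ⟨z, h1, h2, h3⟩
              refine ⟨z, h1, ?_, h3⟩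
              rcases h2.eq_or_lt with rfl | h2
              · exact absurd h3 hφ
              · exact h2
            · rintro ⟨z, h1, h2, h3⟩
              exact ⟨z, h1, by omega, h3⟩
          simp only [e]
          obtain ⟨t1, ht1, h1⟩ := hstep (x + 1) hxs (false, none, none)
          obtain ⟨y, hy, a, t2, ht2, h2⟩ := ihn (x + 1) hxs (by clear * - hn; omega)
          refine ⟨y, hy, a, 1 + ((1 + t1) + t2), ?_, .loopStep rfl ?_ (.seq (.ops ?_) h1) h2⟩
          · rw [Nat.succ_mul]; omega
          · simp [Op.run, heads, hφ, hxs]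
          · simp only [runOps_cons, Op.run, runOps_nil, hφ, decide_false]
            rw [runOps_moveRight (a := s[x]) (l := (s.take x).reverse) (r := s.drop (x + 1))
              (by simp [heads])]
            congr 2
            rw [heads_update, heads_update, update_idem, List.take_add_one]
            rw [List.getElem?_eq_getElem hxs, Option.toList_some, List.reverse_append]
            rfl
    -- The search begins, and after rewinding ends, with `d` at its value in `r`.
    have hd0 : update r d 0 = r := by
      rw [← hb d (.inl rfl), update_eq_self]
    obtain ⟨t1, ht1, h1⟩ := hstep 0 (Nat.zero_le _) q
    obtain ⟨y, hy, a, t2, ht2, h2⟩ := hloop s.length 0 (Nat.zero_le _) (by omega)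
    have h3 := rewind_runs (c := []) (o := o) (v := d) (s.take y).reverse
      (h := heads s (update r d y)) (r := s.drop y) (by simp [heads])
      (decide (∃ z ≤ s.length, 0 ≤ z ∧ φ.Eval s (update r d z)), a, none)
    rw [hd0] at h1 h2
    have e1 : update (heads s (update r d y)) d ([], (s.take y).reverse.reverse ++ s.drop y) =
        heads s r := by
      nth_rewrite 2 [← hd0]
      rw [heads_update, heads_update, update_idem]
      simp
    have e2 : decide (∃ z ≤ s.length, 0 ≤ z ∧ φ.Eval s (update r d z)) =
        decide ((ex d φ).Eval s r) := by
      rw [decide_eq_decide]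
      simp [Eval]
    rw [e1, e2] at h3
    rw [e2] at h2
    refine ⟨(t1 + t2) + (2 * (s.take y).reverse.length + 1), ?_, .seq (.seq h1 h2) h3⟩
    simp only [time, Polynomial.eval_add, Polynomial.eval_mul, Polynomial.eval_ofNat, ← hT,
      List.length_reverse, List.length_take]
    have : s.length * (T + 2) ≤ N.eval m * (T + 2) := Nat.mul_le_mul_right _ hN
    have : min y s.length ≤ N.eval m := (min_le_right _ _).trans hN
    -- Each position costs at most `T + 2` in the search and 2 in the rewinding.
    rw [show N.eval m * (T + 4) = N.eval m * (T + 2) + 2 * N.eval m by ring]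
    omega

end Formulas

/-! ### Machines that decide first-order properties of strings -/

section Deciders

open Function Turing

variable {V : Type} [DecidableEq V] {c : List Sym} {o : List Bool}

theorem runOps_pushes (f : St → Sym) (q : St) (l r : List Sym) (vs : List V) :
    ∀ h : V → List Sym × List Sym, vs.Nodup → (∀ v ∈ vs, h v = (l, r)) →
      runOps (vs.map fun v => Op.push (.left v) f) (q, cells h c o) =
        (q, cells (fun v => if v ∈ vs then (f q :: l, r) else h v) c o) := by
  induction vs with
  | nil => intro h _ _; simp
  | cons v vs ih =>
    intro h hn hv
    rw [List.nodup_cons] at hn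
    rw [List.map_cons, runOps_cons]
    simp only [Op.run, cells_left, update_cells_left, hv v List.mem_cons_self]
    rw [ih _ hn.2]
    · congr 2
      funext w
      by_cases hw : w = v
      · subst hw; simp [hn.1]
      · simp [hw]
    · intro w hw
      have : w ≠ v := by rintro rfl; exact hn.1 hw
      rw [update_of_ne this]
      exact hv w (List.mem_cons_of_mem _ hw)

/-- Execute a program for each variable from a list. -/
def forEach (vs : List V) (P : V → Prog (Stk.Alphabet (V := V)) St) :
    Prog (Stk.Alphabet (V := V)) St :=
  vs.foldr (fun v Q => .seq (P v) Q) (.ops [])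

theorem forEach_runs {P : V → Prog (Stk.Alphabet (V := V)) St} {q : St} {B : ℕ}
    {x y : List Sym × List Sym}
    (hP : ∀ (v : V) (h : V → List Sym × List Sym), h v = x →
      Runs (P v) (q, cells h c o) (q, cells (update h v y) c o) B) (vs : List V) :
    ∀ h : V → List Sym × List Sym, vs.Nodup → (∀ v ∈ vs, h v = x) →
      Runs (forEach vs P) (q, cells h c o)
        (q, cells (fun v => if v ∈ vs then y else h v) c o) (vs.length * B + 1) := by
  induction vs with
  | nil =>
    intro h _ _
    rw [List.length_nil, Nat.zero_mul, Nat.zero_add]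
    exact .ops (by simp)
  | cons v vs ih =>
    intro h hn hv
    rw [List.nodup_cons] at hn
    have h1 := ih (update h v y) hn.2 (fun w hw => by
      have : w ≠ v := by rintro rfl; exact hn.1 hw
      rw [update_of_ne this]
      exact hv w (List.mem_cons_of_mem _ hw))
    rw [List.length_cons, show (vs.length + 1) * B + 1 = B + (vs.length * B + 1) by ring]
    have e : (fun w => if w ∈ v :: vs then y else h w) =
        fun w => if w ∈ vs then y else update h v y w := by
      funext w
      by_cases hw : w = v
      · subst hw; simp
      · simp [hw]
    rw [e]
    exact .seq (hP v h (hv v List.mem_cons_self)) h1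

/-- Copy the input to the stacks of all variables. -/
def copyLoop (vs : List V) : Prog (Stk.Alphabet (V := V)) St :=
  .loop [.pop .inp fun q a => (q.1, a, none)] (fun q => q.2.1.isSome)
    (.ops (vs.map fun v => Op.push (.left v) fun q => q.2.1.getD .zero))

/-- Moving symbols from one stack to another reverses them. The left stacks hold the text before a
position in reverse, so that afterwards all variables stand at the end of the string. -/
theorem copyLoop_runs {vs : List V} (hn : vs.Nodup) (hvs : ∀ v, v ∈ vs) (f : Bool)
    (c : List Sym) : ∀ (l : List Sym) (q : St), q.1 = f →
      Runs (copyLoop vs) (q, cells (fun _ => (l, [])) c o)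
        ((f, none, none), cells (fun _ => (c.reverse ++ l, [])) [] o) (2 * c.length + 1) := by
  induction c with
  | nil =>
    rintro l q rfl
    exact .loopDone (by simp [Op.run]) rfl
  | cons a c ih =>
    rintro l q rfl
    have h1 := ih (a :: l) (q.1, some a, none) rfl
    rw [List.length_cons, show 2 * (c.length + 1) + 1 = 1 + (1 + (2 * c.length + 1)) by ring,
      List.reverse_cons, List.append_assoc, List.singleton_append]
    refine .loopStep rfl (by simp [Op.run]) (.ops ?_) h1
    simp only [runOps_cons, Op.run, runOps_nil, cells_inp, update_cells_inp, List.tail_cons,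
      List.head?_cons]
    rw [runOps_pushes _ _ l [] vs _ hn (fun _ _ => rfl)]
    simp [hvs]

/-- Remove the string after the position of a variable. -/
def clear (v : V) : Prog (Stk.Alphabet (V := V)) St :=
  .loop [.pop (.right v) fun q a => (q.1, a, none)] (fun q => q.2.1.isSome) (.ops [])

theorem clear_runs {v : V} (f : Bool) (r : List Sym) :
    ∀ (h : V → List Sym × List Sym) (q : St), q.1 = f → h v = ([], r) →
      Runs (clear v) (q, cells h c o) ((f, none, none), cells (update h v ([], [])) c o)
        (2 * r.length + 1) := by
  induction r with
  | nil =>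
    rintro h q rfl hv
    exact .loopDone (by simp [Op.run, hv]) rfl
  | cons a r ih =>
    rintro h q rfl hv
    have h1 := ih (update h v ([], r)) (q.1, some a, none) rfl (by simp)
    rw [update_idem] at h1
    rw [List.length_cons, show 2 * (r.length + 1) + 1 = 1 + (1 + (2 * r.length + 1)) by ring]
    exact .loopStep (c' := ((q.1, some a, none), cells (update h v ([], r)) c o))
      (by simp [Op.run, hv]) rfl (.ops rfl) h1

/-- The program that writes the truth value of a formula on the output stack. -/
def Fml.decider (vs : List V) (φ : Fml V) : Prog (Stk.Alphabet (V := V)) St :=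
  .seq (.ops (vs.map fun v => Op.push (.left v) fun _ => .endWord)) <| .seq (copyLoop vs) <|
    .seq (forEach vs rewind) <| .seq φ.prog <| .seq (forEach vs clear) <|
    .ops [.push .out fun q => q.1, .load fun _ => (false, none, none)]

open Classical in
-- The mark `.endWord` put below the copies guards the beginning: the first word, too, is then
-- preceded by an end mark. The final clearing and the reset of the state are due to the definition
-- of output, which requires the initial state and all stacks but the output stack to be empty.
theorem Fml.decider_runs {vs : List V} (hn : vs.Nodup) (hvs : ∀ v, v ∈ vs) {φ : Fml V}
    (hφ : φ.Proper) (s : List Sym) :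
    ∃ t ≤ (2 * vs.length * (2 * s.length + 3) + 2 * s.length + 5 +
        (φ.time (Polynomial.X + 1)).eval s.length),
      Runs (φ.decider vs) ((false, none, none), cells (fun _ => ([], [])) s [])
        ((false, none, none), cells (fun _ => ([], [])) []
          [decide (φ.Eval (.endWord :: s) fun _ => 0)]) t := by
  obtain ⟨t, ht, h1⟩ := φ.prog_runs (o := []) (.endWord :: s) (N := Polynomial.X + 1)
    (m := s.length) (by simp) hφ (fun _ => 0) (fun _ => Nat.zero_le _) (fun _ _ => rfl)
    (false, none, none)
  have e : heads (V := V) (.endWord :: s) (fun _ => 0) = fun _ => ([], .endWord :: s) := by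
    funext v
    simp [heads]
  rw [e] at h1
  have h2 : Runs (forEach vs rewind)
      ((false, none, none), cells (fun _ => (s.reverse ++ [Sym.endWord], [])) [] [])
      ((false, none, none), cells (fun _ => ([], .endWord :: s)) [] [])
      (vs.length * (2 * s.length + 3) + 1) := by
    -- The bound is `2 * (s.length + 1) + 1`, where the inner 1 accounts for the guard.
    have := forEach_runs (c := []) (o := []) (P := rewind) (q := (false, none, none))
      (B := 2 * s.length + 3) (x := (s.reverse ++ [Sym.endWord], [])) (y := ([], .endWord :: s))
      (fun v h hv => by
        have := rewind_runs (c := []) (o := []) _ hv (false, none, none)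
        convert this using 1
        · simp
        · simp; ring) vs _ hn (fun _ _ => rfl)
    simpa only [hvs, if_true] using this
  have h3 : Runs (forEach vs clear)
      ((decide (φ.Eval (.endWord :: s) fun _ => 0), none, none),
        cells (fun _ => ([], .endWord :: s)) [] [])
      ((decide (φ.Eval (.endWord :: s) fun _ => 0), none, none), cells (fun _ => ([], [])) [] [])
      (vs.length * (2 * s.length + 3) + 1) := by
    have := forEach_runs (c := []) (o := []) (P := clear)
      (q := (decide (φ.Eval (.endWord :: s) fun _ => 0), none, none))
      (B := 2 * s.length + 3) (x := ([], .endWord :: s)) (y := ([], []))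
      (fun v h hv => clear_runs (c := []) (o := []) _ _ h _ rfl hv) vs _ hn (fun _ _ => rfl)
    simpa only [hvs, if_true] using this
  have h0 := copyLoop_runs (o := []) hn hvs false s [.endWord] (false, none, none) rfl
  refine ⟨1 + ((2 * s.length + 1) + ((vs.length * (2 * s.length + 3) + 1) + (t +
    ((vs.length * (2 * s.length + 3) + 1) + 1)))), ?_,
    .seq (.ops ?_) (.seq h0 (.seq h2 (.seq h1 (.seq h3 (.ops ?_)))))⟩
  · rw [mul_assoc]; omega
  · rw [runOps_pushes _ _ [] [] vs _ hn (fun _ _ => rfl)]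
    simp only [hvs, if_true]
  · simp [Op.run]

/-- The machine for a formula. -/
def Fml.machine [Fintype V] (vs : List V) (φ : Fml V) : FinTM2 where
  K := Stk V
  k₀ := .inp
  k₁ := .out
  Γ := Stk.Alphabet
  Λ := Option (φ.decider vs).Label
  main := some (φ.decider vs).entry
  σ := St
  initialState := (false, none, none)
  Γk₀Fin := inferInstanceAs (Fintype Sym)
  m x := Option.rec .halt (fun y => (φ.decider vs).code some none y) x

/-- The machine for a formula, with its input and output alphabets. -/
def Fml.machineAux [Fintype V] (vs : List V) (φ : Fml V) : TM2ComputableAux Sym Bool where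
  tm := φ.machine vs
  inputAlphabet := Equiv.refl Sym
  outputAlphabet := Equiv.refl Bool

theorem Fml.initList_machine [Fintype V] (vs : List V) (φ : Fml V) (s : List Sym) :
    initList (φ.machine vs) s =
      ⟨some (some (φ.decider vs).entry), (false, none, none), cells (fun _ => ([], [])) s []⟩ := by
  unfold initList
  congr 1
  funext k
  cases k <;> rfl

theorem Fml.haltList_machine [Fintype V] (vs : List V) (φ : Fml V) (l : List Bool) :
    haltList (φ.machine vs) l =
      ⟨none, (false, none, none), cells (fun _ => ([], [])) [] l⟩ := by
  unfold haltList
  congr 1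
  funext k
  cases k <;> rfl

theorem Fml.exists_machine [Fintype V] {φ : Fml V} (hφ : φ.Proper) :
    ∃ (M : TM2ComputableAux Sym Bool) (p : Polynomial ℕ), ∀ (s : List Sym) (b : Bool),
      (b = true ↔ φ.Eval (.endWord :: s) fun _ => 0) →
        ∀ t, p.eval s.length ≤ t → AnswersWithin M s b t := by
  classical
  set vs := (Finset.univ : Finset V).toList with hvs
  refine ⟨φ.machineAux vs, 2 * (vs.length : Polynomial ℕ) * (2 * Polynomial.X + 3) + 2 * Polynomial.X + 6 +
    φ.time (Polynomial.X + 1), fun s b hb t ht => ?_⟩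
  obtain ⟨t', ht', hrun⟩ := φ.decider_runs (vs := vs) (Finset.nodup_toList _) (by simp [hvs]) hφ s
  have hsteps := hrun.steps (φ.machine vs).m some none fun _ => rfl
  have hb' : b = decide (φ.Eval (.endWord :: s) fun _ => 0) := by
    rw [Bool.eq_iff_iff, hb, decide_eq_true_iff]
  -- The exit label costs one further step, hence 6 instead of 5 in the time bound.
  have hhalt : Steps (φ.machine vs).m 1
      ⟨some none, (false, none, none), cells (fun _ => ([], [])) [] [b]⟩
      ⟨none, (false, none, none), cells (fun _ => ([], [])) [] [b]⟩ := Steps.one rfl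
  rw [← hb'] at hsteps
  refine ⟨⟨⟨t' + 1, ?_⟩, ?_⟩⟩
  · have h1 : s.map (φ.machineAux vs).inputAlphabet.symm = s := List.map_id s
    have h2 : [b].map (φ.machineAux vs).outputAlphabet.symm = [b] := List.map_id [b]
    have key : Steps (φ.machine vs).m (t' + 1) (initList (φ.machine vs) s)
        (haltList (φ.machine vs) [b]) := by
      have e1 := φ.initList_machine vs s
      have e2 := φ.haltList_machine vs [b]
      exact e1 ▸ e2 ▸ hsteps.trans hhalt
    rw [h1, h2]
    exact key
  · refine le_trans ?_ ht
    simp only [Polynomial.eval_add, Polynomial.eval_mul, Polynomial.eval_natCast,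
      Polynomial.eval_ofNat, Polynomial.eval_X, Nat.cast_id]
    omega

end Deciders

/-! ### Derived formulas -/

section Derived

open Function

namespace Fml

variable {V : Type}

/-- A true formula. -/
def tru [Inhabited V] : Fml V := not (sym default fun _ => false)

/-- Conjunction of a list of formulas. -/
def conj [Inhabited V] (l : List (Fml V)) : Fml V := l.foldr and tru

/-- Equivalence of formulas. -/
def iff (φ ψ : Fml V) : Fml V := and (not (and φ (not ψ))) (not (and ψ (not φ)))

/-- Existential quantification over a list of variables. -/
def exs (l : List V) (φ : Fml V) : Fml V := l.foldr ex φ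

/-- The position `i` is not after the position `j`. -/
def le (i j : V) : Fml V := scan i j (fun _ _ => true) fun a _ => a.isNone

/-- The position `i` is before the position `j`. -/
def lt (i j : V) : Fml V := not (le j i)

@[simp] theorem proper_sym {v : V} {f : Sym → Bool} : (sym v f).Proper := trivial

@[simp] theorem proper_not {φ : Fml V} : (not φ).Proper ↔ φ.Proper := Iff.rfl

@[simp] theorem proper_and {φ ψ : Fml V} : (and φ ψ).Proper ↔ φ.Proper ∧ ψ.Proper := Iff.rfl

@[simp] theorem proper_iff {φ ψ : Fml V} : (iff φ ψ).Proper ↔ φ.Proper ∧ ψ.Proper := by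
  simp only [iff, proper_and, proper_not]
  tauto

@[simp] theorem proper_scan {i j : V} {cont res} : (scan i j cont res).Proper ↔ i ≠ j := Iff.rfl

@[simp] theorem proper_le {i j : V} : (le i j).Proper ↔ i ≠ j := Iff.rfl

@[simp] theorem proper_lt {i j : V} : (lt i j).Proper ↔ j ≠ i := Iff.rfl

@[simp] theorem binds_sym {v d : V} {f : Sym → Bool} : ¬ (sym v f).Binds d := id

@[simp] theorem binds_scan {i j d : V} {cont res} : ¬ (scan i j cont res).Binds d := id

@[simp] theorem binds_le {i j d : V} : ¬ (le i j).Binds d := id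

@[simp] theorem binds_lt {i j d : V} : ¬ (lt i j).Binds d := id

@[simp] theorem binds_not {φ : Fml V} {d : V} : (not φ).Binds d ↔ φ.Binds d := Iff.rfl

@[simp] theorem binds_and {φ ψ : Fml V} {d : V} :
    (and φ ψ).Binds d ↔ φ.Binds d ∨ ψ.Binds d := Iff.rfl

@[simp] theorem binds_iff {φ ψ : Fml V} {d : V} :
    (iff φ ψ).Binds d ↔ φ.Binds d ∨ ψ.Binds d := by
  simp only [iff, binds_and, binds_not]
  tauto

@[simp] theorem proper_conj [Inhabited V] {l : List (Fml V)} :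
    (conj l).Proper ↔ ∀ φ ∈ l, φ.Proper := by
  induction l with
  | nil => simp [conj, tru]
  | cons φ l ih =>
    rw [List.forall_mem_cons, ← ih]
    rfl

@[simp] theorem binds_conj [Inhabited V] {l : List (Fml V)} {d : V} :
    (conj l).Binds d ↔ ∃ φ ∈ l, φ.Binds d := by
  induction l with
  | nil => simp [conj, tru]
  | cons φ l ih =>
    rw [List.exists_mem_cons_iff, ← ih]
    rfl

@[simp] theorem binds_exs {l : List V} {φ : Fml V} {d : V} :
    (exs l φ).Binds d ↔ d ∈ l ∨ φ.Binds d := by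
  induction l with
  | nil => simp [exs]
  | cons e l ih =>
    rw [List.mem_cons, or_assoc, ← ih]
    rfl

@[simp] theorem proper_exs {l : List V} {φ : Fml V} :
    (exs l φ).Proper ↔ l.Nodup ∧ (∀ d ∈ l, ¬ φ.Binds d) ∧ φ.Proper := by
  induction l with
  | nil => simp [exs]
  | cons e l ih =>
    have h : (exs (e :: l) φ).Proper ↔ ¬ (exs l φ).Binds e ∧ (exs l φ).Proper := Iff.rfl
    rw [h, ih, binds_exs, List.nodup_cons, List.forall_mem_cons]
    tauto

variable [DecidableEq V] {s : List Sym} {r : V → ℕ}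

@[simp] theorem eval_sym {v : V} {f : Sym → Bool} :
    (sym v f).Eval s r ↔ ∃ a ∈ s[r v]?, f a = true := Iff.rfl

@[simp] theorem eval_not {φ : Fml V} : (not φ).Eval s r ↔ ¬ φ.Eval s r := Iff.rfl

@[simp] theorem eval_and {φ ψ : Fml V} : (and φ ψ).Eval s r ↔ φ.Eval s r ∧ ψ.Eval s r := Iff.rfl

@[simp] theorem eval_iff {φ ψ : Fml V} : (iff φ ψ).Eval s r ↔ (φ.Eval s r ↔ ψ.Eval s r) := by
  simp only [iff, eval_and, eval_not]
  tauto

@[simp] theorem eval_conj [Inhabited V] {l : List (Fml V)} :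
    (conj l).Eval s r ↔ ∀ φ ∈ l, φ.Eval s r := by
  induction l with
  | nil => simp [conj, tru]
  | cons φ l ih =>
    rw [List.forall_mem_cons, ← ih]
    rfl

/-- Updates at the variables of `l`, one after another, reach every admissible valuation that agrees
with `r` outside `l`. -/
theorem eval_exs (l : List V) (φ : Fml V) : ∀ r : V → ℕ, (∀ v, r v ≤ s.length) →
    ((exs l φ).Eval s r ↔
      ∃ r' : V → ℕ, (∀ v, r' v ≤ s.length) ∧ (∀ v, v ∉ l → r' v = r v) ∧ φ.Eval s r') := by
  induction l with
  | nil =>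
    intro r hr
    constructor
    · exact fun h => ⟨r, hr, fun _ _ => rfl, h⟩
    · rintro ⟨r', -, h1, h2⟩
      rwa [← (funext fun v => h1 v List.not_mem_nil : r' = r)]
  | cons d l ih =>
    intro r hr
    have hup (x : ℕ) (hx : x ≤ s.length) (v : V) : update r d x v ≤ s.length := by
      by_cases hv : v = d
      · subst hv; simpa using hx
      · simpa [hv] using hr v
    constructor
    · rintro ⟨x, hx, h⟩
      obtain ⟨r', h1, h2, h3⟩ := (ih _ (hup x hx)).1 h
      refine ⟨r', h1, fun v hv => ?_, h3⟩
      rw [List.mem_cons, not_or] at hv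
      rw [h2 v hv.2, update_of_ne hv.1]
    · rintro ⟨r', h1, h2, h3⟩
      refine ⟨r' d, h1 d, (ih _ (hup _ (h1 d))).2 ⟨r', h1, fun v hv => ?_, h3⟩⟩
      by_cases hd : v = d
      · subst hd; simp
      · rw [update_of_ne hd]
        exact h2 v (by simp [hd, hv])

/-- A comparison that never stops early stops at the end of the shorter string. This makes the order
of positions an instance of `scan`. -/
theorem scan_length (as : List Sym) : ∀ bs : List Sym,
    CheckId.scan (fun _ _ => true) (fun a _ => a.isNone) as bs = true ↔
      as.length ≤ bs.length := by
  induction as with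
  | nil => intro bs; simp [CheckId.scan]
  | cons a as ih =>
    intro bs
    cases bs with
    | nil => simp [CheckId.scan]
    | cons b bs => simpa [CheckId.scan] using ih bs

theorem eval_le (hr : ∀ v, r v ≤ s.length) {i j : V} : (le i j).Eval s r ↔ r i ≤ r j := by
  simp only [le, Eval, scan_length, List.length_reverse, List.length_take]
  rw [min_eq_left (hr i), min_eq_left (hr j)]

theorem eval_lt (hr : ∀ v, r v ≤ s.length) {i j : V} : (lt i j).Eval s r ↔ r i < r j := by
  rw [lt, eval_not, eval_le hr, not_le]

end Fml

end Derived

/-! ### The formula for an inclusion between polynomials -/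

/-- The symbol is a binary digit. -/
def Sym.isBit : Sym → Bool
  | zero => true
  | one => true
  | _ => false

/-- The symbol ends a word or a side. -/
def Sym.isEnd : Sym → Bool
  | endWord => true
  | endSide => true
  | _ => false

/-- The position `z` of the string `s` does not hold a binary digit. -/
def NonBit (s : List Sym) (z : ℕ) : Prop := ∃ a ∈ s[z]?, (!a.isBit) = true

/-- The part of the string strictly between `b` and `e` is a word. -/
def IsWord (s : List Sym) (b e : ℕ) : Prop :=
  (∃ a ∈ s[b]?, a.isEnd = true) ∧ s[e]? = some .endWord ∧ b < e ∧
    ∀ z, b < z → z < e → ¬ ∃ a ∈ s[z]?, a.isEnd = true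

/-- The position `e` is on the left-hand side (for `sd = false`) or on the right-hand side (for
`sd = true`). -/
def OnSide (s : List Sym) (sd : Bool) (e : ℕ) : Prop :=
  sd = true ↔ ∃ z ≤ e, s[z]? = some .endSide

/-- There is an occurrence of a variable that ends at the position `x` of the word between `b`
and `e`. -/
def IsLetter (s : List Sym) (b e x : ℕ) : Prop := b < x ∧ x < e ∧ s[x]? = some .endVar

/-- The binary digits that precede the positions `x` and `y` are the same. -/
def SameVar (s : List Sym) (x y : ℕ) : Prop :=
  scan (fun a b => decide (a = b) && a.isBit)
    (fun a b => !a.any Sym.isBit && !b.any Sym.isBit) (s.take x).reverse (s.take y).reverse = true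

/-- Each way to cut a word from the side `sd` into `m + 1` blocks is imitated by a way to cut some
word from the side `sd'` such that each occurrence of a variable in the latter word has a
counterpart in the former. -/
def Included (s : List Sym) (m : ℕ) (sd sd' : Bool) : Prop :=
  ∀ (b e : ℕ) (c : Fin m → ℕ), IsWord s b e → OnSide s sd e → (∀ i, NonBit s (c i)) →
    (∀ i j, i < j → c i ≤ c j) →
    ∃ (b' e' : ℕ) (d : Fin m → ℕ), IsWord s b' e' ∧ OnSide s sd' e' ∧ (∀ i, NonBit s (d i)) ∧
      (∀ i, (c i ≤ b ↔ d i ≤ b') ∧ (c i < e ↔ d i < e')) ∧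
      ∀ x, IsLetter s b' e' x → ∃ y, IsLetter s b e y ∧ SameVar s x y ∧
        ∀ i, (c i < y ↔ d i < x) ∧ (c i ≤ y ↔ d i ≤ x)

theorem lt_length_of_mem {s : List Sym} {z : ℕ} {a : Sym} (h : a ∈ s[z]?) : z < s.length :=
  (List.getElem?_eq_some_iff.1 h).1

/-- The variables of the formula. -/
inductive Var (m : ℕ) : Type
  | B
  | E
  | C (i : Fin m)
  | B'
  | E'
  | D (i : Fin m)
  | X
  | Y
  | Z
  deriving DecidableEq, Fintype

namespace Fml

open Var

variable {m : ℕ}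

instance : Inhabited (Var m) := ⟨B⟩

/-- The formula for `IsWord`. -/
def word (b e : Var m) : Fml (Var m) :=
  conj [sym b Sym.isEnd, sym e fun a => a = .endWord, lt b e,
    not (exs [Z] (conj [lt b Z, lt Z e, sym Z Sym.isEnd]))]

/-- The formula for `OnSide`. -/
def side (sd : Bool) (e : Var m) : Fml (Var m) :=
  cond sd (exs [Z] (and (le Z e) (sym Z fun a => a = .endSide)))
    (not (exs [Z] (and (le Z e) (sym Z fun a => a = .endSide))))

/-- The formula for `IsLetter`. -/
def letter (b e x : Var m) : Fml (Var m) :=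
  conj [lt b x, lt x e, sym x fun a => a = .endVar]

/-- The formula for `SameVar`. -/
def same (x y : Var m) : Fml (Var m) :=
  scan x y (fun a b => decide (a = b) && a.isBit)
    fun a b => !a.any Sym.isBit && !b.any Sym.isBit

/-- Conjunction over all indices. -/
def allIdx (f : Fin m → Fml (Var m)) : Fml (Var m) := conj ((List.finRange m).map f)

/-- Each occurrence of a variable in the second word has a counterpart in the first one. -/
def imitates : Fml (Var m) :=
  not (exs [X] (and (letter B' E' X) (not (exs [Y] (conj [letter B E Y, same X Y,
    allIdx fun i => and (iff (lt (C i) Y) (lt (D i) X)) (iff (le (C i) Y) (le (D i) X))])))))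

/-- The second word imitates the first one. -/
def imitation (sd' : Bool) : Fml (Var m) :=
  exs (B' :: E' :: (List.finRange m).map D) (conj [word B' E', side sd' E',
    allIdx fun i => sym (D i) fun a => !a.isBit,
    allIdx fun i => and (iff (le (C i) B) (le (D i) B')) (iff (lt (C i) E) (lt (D i) E')),
    imitates])

/-- The formula for `Included`. -/
def included (m : ℕ) (sd sd' : Bool) : Fml (Var m) :=
  not (exs (B :: E :: (List.finRange m).map C) (conj [word B E, side sd E,
    allIdx fun i => sym (C i) fun a => !a.isBit,
    allIdx fun i => allIdx fun j => if i < j then le (C i) (C j) else tru,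
    not (imitation sd')]))

/-! ### Agreement of the formulas with the properties of positions -/

variable {s : List Sym} {r : Var m → ℕ}

@[simp] theorem eval_allIdx {f : Fin m → Fml (Var m)} :
    (allIdx f).Eval s r ↔ ∀ i, (f i).Eval s r := by
  simp [allIdx]

theorem update_le (hr : ∀ v, r v ≤ s.length) {z : ℕ} (hz : z ≤ s.length) (v w : Var m) :
    Function.update r v z w ≤ s.length := by
  by_cases hw : w = v
  · subst hw; simpa using hz
  · simpa [hw] using hr w

/-- Quantifiers in formulas are bounded by the length of the string, those in `IsWord` are not. The
difference is immaterial, since only positions below `r e` matter; the other translations use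
similar bounds. -/
theorem eval_word (hr : ∀ v, r v ≤ s.length) {b e : Var m} (hb : b ≠ Z) (he : e ≠ Z) :
    (word b e).Eval s r ↔ IsWord s (r b) (r e) := by
  have h (z : ℕ) (hz : z ≤ s.length) :
      (conj [lt b Z, lt Z e, sym Z Sym.isEnd]).Eval s (Function.update r Z z) ↔
        r b < z ∧ z < r e ∧ ∃ a ∈ s[z]?, a.isEnd = true := by
    simp [eval_lt (update_le hr hz Z), hb, he]
  have h2 : (exs [Z] (conj [lt b Z, lt Z e, sym Z Sym.isEnd])).Eval s r ↔
      ∃ z, r b < z ∧ z < r e ∧ ∃ a ∈ s[z]?, a.isEnd = true := by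
    constructor
    · rintro ⟨z, hz, h1⟩
      exact ⟨z, (h z hz).1 h1⟩
    · rintro ⟨z, h1⟩
      have hz := (h1.2.1.le.trans (hr e))
      exact ⟨z, hz, (h z hz).2 h1⟩
  simp only [word, eval_conj, List.forall_mem_cons, eval_not, h2, eval_lt hr, eval_sym, IsWord]
  simp only [List.not_mem_nil, false_imp_iff, implies_true, and_true, decide_eq_true_eq,
    exists_eq_right, Option.mem_def, not_exists, not_and]

theorem eval_side (hr : ∀ v, r v ≤ s.length) {sd : Bool} {e : Var m} (he : e ≠ Z) :
    (side sd e).Eval s r ↔ OnSide s sd (r e) := by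
  have h2 : (exs [Z] (and (le Z e) (sym Z fun a => a = .endSide))).Eval s r ↔
      ∃ z ≤ r e, s[z]? = some .endSide := by
    constructor
    · rintro ⟨z, hz, h1⟩
      simp [eval_le (update_le hr hz Z), he] at h1
      exact ⟨z, h1⟩
    · rintro ⟨z, h1, h3⟩
      have hz := h1.trans (hr e)
      refine ⟨z, hz, ?_⟩
      simp [eval_le (update_le hr hz Z), he, h1, h3]
  cases sd
  · simp only [side, cond_false, eval_not, h2, OnSide, Bool.false_eq_true, false_iff]
  · simp only [side, cond_true, h2, OnSide, true_iff]

theorem eval_letter (hr : ∀ v, r v ≤ s.length) {b e x : Var m} :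
    (letter b e x).Eval s r ↔ IsLetter s (r b) (r e) (r x) := by
  simp [letter, eval_lt hr, IsLetter]

theorem eval_imitates (hr : ∀ v, r v ≤ s.length) : (imitates (m := m)).Eval s r ↔
    ∀ x, IsLetter s (r B') (r E') x → ∃ y, IsLetter s (r B) (r E) y ∧ SameVar s x y ∧
        ∀ i, (r (C i) < y ↔ r (D i) < x) ∧ (r (C i) ≤ y ↔ r (D i) ≤ x) := by
  have h1 (x : ℕ) (hx : x ≤ s.length) (y : ℕ) (hy : y ≤ s.length) :
      (conj [letter B E Y, same X Y, allIdx fun i => and (iff (lt (C i) Y) (lt (D i) X))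
        (iff (le (C i) Y) (le (D i) X))]).Eval s
          (Function.update (Function.update r X x) Y y) ↔
        IsLetter s (r B) (r E) y ∧ SameVar s x y ∧
          ∀ i, (r (C i) < y ↔ r (D i) < x) ∧ (r (C i) ≤ y ↔ r (D i) ≤ x) := by
    have := update_le (update_le hr hx X) hy Y
    simp only [eval_conj, List.forall_mem_cons, eval_letter this, eval_allIdx, eval_and, eval_iff,
      eval_lt this, eval_le this]
    simp [same, Eval, SameVar]
  have h2 (x : ℕ) (hx : x ≤ s.length) : (exs [Y] (conj [letter B E Y, same X Y,
      allIdx fun i => and (iff (lt (C i) Y) (lt (D i) X))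
        (iff (le (C i) Y) (le (D i) X))])).Eval s (Function.update r X x) ↔
      ∃ y, IsLetter s (r B) (r E) y ∧ SameVar s x y ∧
        ∀ i, (r (C i) < y ↔ r (D i) < x) ∧ (r (C i) ≤ y ↔ r (D i) ≤ x) := by
    constructor
    · rintro ⟨y, hy, h⟩
      exact ⟨y, (h1 x hx y hy).1 h⟩
    · rintro ⟨y, h⟩
      have hy := h.1.2.1.le.trans (hr E)
      exact ⟨y, hy, (h1 x hx y hy).2 h⟩
  have h3 (x : ℕ) (hx : x ≤ s.length) : (letter B' E' X).Eval s (Function.update r X x) ↔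
      IsLetter s (r B') (r E') x := by
    rw [eval_letter (update_le hr hx X)]
    simp
  rw [imitates, eval_not]
  constructor
  · intro h x hx
    have hx' := hx.2.1.le.trans (hr E')
    by_contra hy
    exact h ⟨x, hx', (h3 x hx').2 hx, fun hc => hy ((h2 x hx').1 hc)⟩
  · rintro h ⟨x, hx', hx, hy⟩
    exact hy ((h2 x hx').2 (h x ((h3 x hx').1 hx)))

theorem eval_imitation (hr : ∀ v, r v ≤ s.length) {sd' : Bool} :
    (imitation (m := m) sd').Eval s r ↔
    ∃ (b' e' : ℕ) (d : Fin m → ℕ), IsWord s b' e' ∧ OnSide s sd' e' ∧ (∀ i, NonBit s (d i)) ∧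
      (∀ i, (r (C i) ≤ r B ↔ d i ≤ b') ∧ (r (C i) < r E ↔ d i < e')) ∧
      ∀ x, IsLetter s b' e' x → ∃ y, IsLetter s (r B) (r E) y ∧ SameVar s x y ∧
        ∀ i, (r (C i) < y ↔ d i < x) ∧ (r (C i) ≤ y ↔ d i ≤ x) := by
  have h1 (r : Var m → ℕ) (hr : ∀ v, r v ≤ s.length) : (conj [word B' E', side sd' E',
      allIdx fun i => sym (D i) fun a => !a.isBit,
      allIdx fun i => and (iff (le (C i) B) (le (D i) B')) (iff (lt (C i) E) (lt (D i) E')),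
      imitates]).Eval s r ↔ IsWord s (r B') (r E') ∧ OnSide s sd' (r E') ∧
        (∀ i, NonBit s (r (D i))) ∧
      (∀ i, (r (C i) ≤ r B ↔ r (D i) ≤ r B') ∧ (r (C i) < r E ↔ r (D i) < r E')) ∧
      ∀ x, IsLetter s (r B') (r E') x → ∃ y, IsLetter s (r B) (r E) y ∧ SameVar s x y ∧
        ∀ i, (r (C i) < y ↔ r (D i) < x) ∧ (r (C i) ≤ y ↔ r (D i) ≤ x) := by
    simp only [eval_conj, List.forall_mem_cons, eval_word hr (b := B') (e := E') nofun nofun,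
      eval_side hr (e := E') nofun, eval_allIdx, eval_and, eval_iff,
      eval_lt hr, eval_le hr, eval_imitates hr, eval_sym, NonBit, List.not_mem_nil, false_imp_iff,
      implies_true, and_true]
  rw [imitation, eval_exs _ _ _ hr]
  constructor
  · rintro ⟨r', hr', h2, h3⟩
    rw [h1 r' hr'] at h3
    have hC (i : Fin m) : r' (C i) = r (C i) := h2 _ (by simp)
    have hB : r' B = r B := h2 _ (by simp)
    have hE : r' E = r E := h2 _ (by simp)
    simp only [hC, hB, hE] at h3
    exact ⟨r' B', r' E', fun i => r' (D i), h3⟩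
  · rintro ⟨b', e', d, h⟩
    -- The witnesses become values of the bound variables. They are admissible because `e'` and all
    -- `d i` carry a symbol and `b' < e'`.
    have hr' : ∀ v : Var m, (match v with
        | B' => b'
        | E' => e'
        | D i => d i
        | v => r v) ≤ s.length := by
      intro v
      have he := lt_length_of_mem h.1.2.1
      cases v with
      | B' => exact (h.1.2.2.1.trans he).le
      | E' => exact he.le
      | D i =>
        obtain ⟨a, ha, -⟩ := h.2.2.1 i
        exact (lt_length_of_mem ha).le
      | _ => exact hr _
    refine ⟨_, hr', fun v hv => ?_, (h1 _ hr').2 h⟩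
    cases v <;> first | rfl | simp at hv

theorem eval_included (hr : ∀ v, r v ≤ s.length) {sd sd' : Bool} :
    (included m sd sd').Eval s r ↔ Included s m sd sd' := by
  have h1 (r : Var m → ℕ) (hr : ∀ v, r v ≤ s.length) : (conj [word B E, side sd E,
      allIdx fun i => sym (C i) fun a => !a.isBit,
      allIdx fun i => allIdx fun j => if i < j then le (C i) (C j) else tru,
      not (imitation sd')]).Eval s r ↔ IsWord s (r B) (r E) ∧ OnSide s sd (r E) ∧
        (∀ i, NonBit s (r (C i))) ∧ (∀ i j, i < j → r (C i) ≤ r (C j)) ∧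
        ¬ (imitation sd').Eval s r := by
    have h2 (i j : Fin m) : (if i < j then le (C i) (C j) else tru).Eval s r ↔
        (i < j → r (C i) ≤ r (C j)) := by
      by_cases hij : i < j
      · simp [hij, eval_le hr]
      · simp [hij, tru]
    simp only [eval_conj, List.forall_mem_cons, eval_word hr (b := B) (e := E) nofun nofun,
      eval_side hr (e := E) nofun, eval_allIdx, h2, eval_sym, NonBit, eval_not, List.not_mem_nil,
      false_imp_iff, implies_true, and_true]
  rw [included, eval_not, eval_exs _ _ _ hr]
  constructor
  · intro h b e c hw hs hc hm
    by_contra hn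
    have hr' : ∀ v : Var m, (match v with
        | B => b
        | E => e
        | C i => c i
        | v => r v) ≤ s.length := by
      intro v
      have he := lt_length_of_mem hw.2.1
      cases v with
      | B => exact (hw.2.2.1.trans he).le
      | E => exact he.le
      | C i =>
        obtain ⟨a, ha, -⟩ := hc i
        exact (lt_length_of_mem ha).le
      | _ => exact hr _
    refine h ⟨_, hr', fun v hv => ?_, (h1 _ hr').2 ⟨hw, hs, hc, hm, ?_⟩⟩
    · cases v <;> first | rfl | simp at hv
    · rw [eval_imitation hr']
      exact hn
  · rintro h ⟨r', hr', -, h2⟩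
    rw [h1 r' hr', eval_imitation hr'] at h2
    exact h2.2.2.2.2 (h _ _ _ h2.1 h2.2.1 h2.2.2.1 h2.2.2.2.1)

theorem proper_included {sd sd' : Bool} : (included m sd sd').Proper := by
  have hC : ((List.finRange m).map (C (m := m))).Nodup :=
    (List.nodup_finRange m).map fun _ _ h => by injection h
  have hD : ((List.finRange m).map (D (m := m))).Nodup :=
    (List.nodup_finRange m).map fun _ _ h => by injection h
  have h1 (i j : Fin m) : (if i < j then le (C i) (C j) else tru).Proper := by
    split_ifs with h
    · simpa using h.ne
    · exact trivial
  have h2 (i j : Fin m) (d : Var m) : ¬ (if i < j then le (C i) (C j) else tru).Binds d := by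
    split_ifs
    · exact id
    · exact id
  cases sd <;> cases sd' <;>
    simp [included, imitation, imitates, word, side, letter, same, allIdx, hC, hD, h1, h2]

end Fml

/-! ### Occurrences of variables in a string -/

/-- The binary notation of a number. -/
def bitSyms (i : ℕ) : List Sym := (Nat.bits i).map fun b => if b then .one else .zero

theorem writeVar_eq (i : ℕ) : writeVar i = bitSyms i ++ [.endVar] := rfl

theorem isBit_of_mem_bitSyms {i : ℕ} {a : Sym} (h : a ∈ bitSyms i) : a.isBit = true := by
  obtain ⟨b, -, rfl⟩ := List.mem_map.1 h
  cases b <;> rfl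

theorem bitSyms_injective : Function.Injective bitSyms := by
  intro i j h
  have h1 : Function.Injective fun b : Bool => if b then Sym.one else Sym.zero := by decide
  have h2 : Nat.bits i = Nat.bits j := List.map_injective_iff.2 h1 h
  have h3 := congrArg (List.map fun b : Bool => cond b 1 0) h2
  rwa [← Nat.digits_two_eq_bits, ← Nat.digits_two_eq_bits, Nat.digits_inj_iff] at h3

/-- An occurrence of the variable `xᵢ` ends at the position `x` of the string `s`. -/
def VarAt (s : List Sym) (x i : ℕ) : Prop :=
  s[x]? = some .endVar ∧ ∃ p c, c.isBit = false ∧ s.take x = p ++ c :: bitSyms i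

/-- The comparison proceeds on equal digits only, so the non-digits `c` and `c'` stop it even if
they coincide. It succeeds only if both delimiters are reached together. -/
theorem scan_bits {c c' : Sym} (hc : c.isBit = false) (hc' : c'.isBit = false) (p p' : List Sym)
    (u : List Sym) : ∀ v : List Sym, (∀ a ∈ u, a.isBit = true) → (∀ a ∈ v, a.isBit = true) →
      (scan (fun a b => decide (a = b) && a.isBit)
        (fun a b => !a.any Sym.isBit && !b.any Sym.isBit) (u ++ c :: p) (v ++ c' :: p') = true ↔
        u = v) := by
  induction u with
  | nil =>
    intro v _ hv
    cases v with
    | nil => simp [scan, hc, hc']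
    | cons b v => simp [scan, hc, hv b List.mem_cons_self]
  | cons a u ih =>
    intro v hu hv
    cases v with
    | nil =>
      have hne : a ≠ c' := by
        rintro rfl
        simp [hc'] at hu
      simp [scan, hne, hu a List.mem_cons_self]
    | cons b v =>
      rw [List.forall_mem_cons] at hu hv
      by_cases hab : a = b
      · subst hab
        simp [scan, hu.1, ih v hu.2 hv.2]
      · simp [scan, hab, hu.1]

theorem VarAt.sameVar_iff {s : List Sym} {x y i j : ℕ} (hx : VarAt s x i) (hy : VarAt s y j) :
    SameVar s x y ↔ i = j := by
  obtain ⟨-, p, c, hc, hp⟩ := hx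
  obtain ⟨-, p', c', hc', hp'⟩ := hy
  rw [SameVar, hp, hp', List.reverse_append, List.reverse_append, List.reverse_cons,
    List.reverse_cons, List.append_assoc, List.append_assoc, List.singleton_append,
    List.singleton_append, scan_bits hc hc' _ _ _ _
      (fun a ha => isBit_of_mem_bitSyms (List.mem_reverse.1 ha))
      (fun a ha => isBit_of_mem_bitSyms (List.mem_reverse.1 ha)), List.reverse_inj,
    bitSyms_injective.eq_iff]

theorem VarAt.unique {s : List Sym} {x i j : ℕ} (hi : VarAt s x i) (hj : VarAt s x j) : i = j :=
  (hi.sameVar_iff hj).1 ((hi.sameVar_iff hi).2 rfl)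

theorem VarAt.nonBit {s : List Sym} {x i : ℕ} (h : VarAt s x i) : NonBit s x :=
  ⟨_, h.1, rfl⟩

/-- The sequence of variables `l` is written in the string `s` strictly between the positions `p`
and `e`, and a word ends at `e`. -/
def WordAt (s : List Sym) (p : ℕ) (l : List ℕ) (e : ℕ) : Prop :=
  ∃ t, s.drop (p + 1) = l.flatMap writeVar ++ .endWord :: t ∧
    e = p + 1 + (l.flatMap writeVar).length

theorem getElem?_of_drop_eq {s u t : List Sym} {p : ℕ} (h : s.drop p = u ++ t) {z : ℕ}
    (h1 : p ≤ z) (h2 : z < p + u.length) : ∃ a ∈ u, s[z]? = some a := by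
  obtain ⟨k, rfl⟩ := Nat.exists_eq_add_of_le h1
  have hk : k < u.length := by omega
  refine ⟨u[k], List.getElem_mem hk, ?_⟩
  rw [← List.getElem?_drop, h, List.getElem?_append_left hk, List.getElem?_eq_getElem hk]

theorem getElem?_add_length_of_drop_eq {s u t : List Sym} {a : Sym} {p : ℕ}
    (h : s.drop p = u ++ a :: t) : s[p + u.length]? = some a := by
  rw [← List.getElem?_drop, h]
  simp

/-! ### Reading the variables of a written word -/

section WordAt

variable {s : List Sym} {p e : ℕ}

theorem WordAt.lt {l : List ℕ} (h : WordAt s p l e) : p < e := by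
  obtain ⟨t, -, rfl⟩ := h
  omega

theorem WordAt.getElem?_end {l : List ℕ} (h : WordAt s p l e) : s[e]? = some .endWord := by
  obtain ⟨t, h1, rfl⟩ := h
  exact getElem?_add_length_of_drop_eq h1

theorem WordAt.not_isEnd {l : List ℕ} (h : WordAt s p l e) {z : ℕ} (hz : p < z) (hz' : z < e) :
    ¬ ∃ a ∈ s[z]?, a.isEnd = true := by
  obtain ⟨t, h1, rfl⟩ := h
  obtain ⟨a, ha, h2⟩ := getElem?_of_drop_eq h1 hz hz'
  rintro ⟨b, hb, hb'⟩
  rw [h2, Option.mem_def, Option.some_inj] at hb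
  subst hb
  obtain ⟨i, -, hi⟩ := List.mem_flatMap.1 ha
  rw [writeVar_eq, List.mem_append, List.mem_singleton] at hi
  rcases hi with hi | rfl
  · have := isBit_of_mem_bitSyms hi
    cases a <;> simp_all [Sym.isBit, Sym.isEnd]
  · simp [Sym.isEnd] at hb'

theorem WordAt.isWord {l : List ℕ} (h : WordAt s p l e) (hp : ∃ a ∈ s[p]?, a.isEnd = true) :
    IsWord s p e :=
  ⟨hp, h.getElem?_end, h.lt, fun _ => h.not_isEnd⟩

/-- The end mark of the first variable plays the role of `p` for the rest of the word. Inductions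
along a word therefore assume only a non-digit at `p`, not the end of a word. -/
theorem WordAt.cons {i : ℕ} {l : List ℕ} (h : WordAt s p (i :: l) e) (hp : NonBit s p) :
    ∃ x, p < x ∧ (∀ z, p < z → z < x → ∃ a ∈ s[z]?, a.isBit = true) ∧ VarAt s x i ∧
      WordAt s x l e := by
  obtain ⟨t, h1, rfl⟩ := h
  rw [List.flatMap_cons, writeVar_eq, List.append_assoc, List.append_assoc,
    List.singleton_append] at h1
  have hd : s.drop (p + 1 + (bitSyms i).length + 1) =
      l.flatMap writeVar ++ .endWord :: t := by
    rw [Nat.add_assoc, ← List.drop_drop, h1, ← List.drop_drop, List.drop_left]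
    rfl
  refine ⟨p + 1 + (bitSyms i).length, by omega, fun z hz hz' => ?_, ⟨?_, ?_⟩, t, hd, ?_⟩
  · obtain ⟨a, ha, h2⟩ := getElem?_of_drop_eq h1 hz hz'
    exact ⟨a, h2, isBit_of_mem_bitSyms ha⟩
  · exact getElem?_add_length_of_drop_eq h1
  · obtain ⟨c, hc, hc'⟩ := hp
    refine ⟨s.take p, c, by simpa using hc', ?_⟩
    rw [List.take_add, h1, List.take_left, List.take_add_one, hc]
    simp
  · simp [writeVar_eq]
    omega

theorem WordAt.exists_varAt {l : List ℕ} : ∀ {p : ℕ}, WordAt s p l e → NonBit s p → ∀ {x : ℕ},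
    IsLetter s p e x → ∃ i, VarAt s x i := by
  induction l with
  | nil =>
    rintro p ⟨t, -, rfl⟩ - x hx
    have h1 := hx.1
    have h2 := hx.2.1
    simp at h2
    omega
  | cons i l ih =>
    intro p h hp x hx
    obtain ⟨y, hy, hbits, hvar, hrest⟩ := h.cons hp
    rcases lt_trichotomy x y with hxy | rfl | hxy
    · obtain ⟨a, ha, ha'⟩ := hbits x hx.1 hxy
      rw [hx.2.2, Option.mem_def, Option.some_inj] at ha
      subst ha
      simp [Sym.isBit] at ha'
    · exact ⟨i, hvar⟩
    · exact ih hrest hvar.nonBit ⟨hxy, hx.2⟩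

end WordAt

/-! ### Paths and cuts -/

/-- There is a path from `i` to `j` that is labelled by the given word, where `R x` is the set of
edges with the label `x`. -/
def Path {S : Type} (R : ℕ → S → S → Prop) : List ℕ → S → S → Prop
  | [], i, j => i = j
  | x :: l, i, j => ∃ k, R x i k ∧ Path R l k j

/-- A predicate on `Fin m` holds precisely for the numbers below `k`. -/
def Below {m : ℕ} (q : Fin m → Prop) (k : Fin (m + 1)) : Prop := ∀ a : Fin m, (a : ℕ) < k ↔ q a

theorem Below.le {m : ℕ} {q q' : Fin m → Prop} {k k' : Fin (m + 1)} (h : Below q k)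
    (h' : Below q' k') (hq : ∀ a, q a → q' a) : k ≤ k' := by
  by_contra hk
  rw [not_le, Fin.lt_def] at hk
  have hm : (k' : ℕ) < m := by omega
  exact lt_irrefl _ ((h' ⟨k', hm⟩).2 (hq _ ((h ⟨k', hm⟩).1 hk)))

theorem Below.unique {m : ℕ} {q : Fin m → Prop} {k k' : Fin (m + 1)} (h : Below q k)
    (h' : Below q k') : k = k' :=
  le_antisymm (h.le h' fun _ => id) (h'.le h fun _ => id)

theorem exists_below {m : ℕ} (q : Fin m → Prop) (hq : ∀ a b, a < b → q b → q a) :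
    ∃ k, Below q k := by
  classical
  have hex : ∃ k, ∀ h : k < m, ¬ q ⟨k, h⟩ := ⟨m, fun h => absurd h (lt_irrefl m)⟩
  have hle : Nat.find hex ≤ m := Nat.find_min' hex fun h => absurd h (lt_irrefl m)
  refine ⟨⟨Nat.find hex, by omega⟩, fun a => ⟨fun ha => ?_, fun ha => ?_⟩⟩
  · have := Nat.find_min hex ha
    push Not at this
    exact this.2
  · by_contra hk
    have hk' : Nat.find hex ≤ a := not_lt.1 hk
    have hlt : Nat.find hex < m := hk'.trans_lt a.2
    rcases hk'.eq_or_lt with h | h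
    · exact Nat.find_spec hex hlt (by convert ha)
    · exact Nat.find_spec hex hlt (hq _ _ h ha)

/-! ### Translation between paths and cuts -/

section Cuts

variable {s : List Sym} {m e : ℕ} {R : ℕ → Fin (m + 1) → Fin (m + 1) → Prop}

/-- After the text up to `p` the path is at the vertex that counts the cuts at positions `≤ p`. A
letter that ends at `x` leads from the number of cuts before `x` to the number of cuts up to `x`:
the cuts at `x` itself are the levels that its edge crosses. -/
theorem WordAt.path_of_cuts {d : Fin m → ℕ} (hd : ∀ a, NonBit s (d a)) {l : List ℕ}
    {j : Fin (m + 1)} (hj : Below (fun a => d a < e) j) :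
    ∀ {p : ℕ} {i : Fin (m + 1)}, WordAt s p l e → NonBit s p → Below (fun a => d a ≤ p) i →
      (∀ x y, IsLetter s p e x → VarAt s x y →
        ∃ k k', R y k k' ∧ Below (fun a => d a < x) k ∧ Below (fun a => d a ≤ x) k') →
      Path R l i j := by
  induction l with
  | nil =>
    rintro p i ⟨t, -, he⟩ - hi -
    have he' : e = p + 1 := by simpa using he
    subst he'
    simp only [Nat.lt_succ_iff] at hj
    exact hi.unique hj
  | cons y l ih =>
    intro p i h hp hi hR
    obtain ⟨x, hpx, hbits, hvar, hrest⟩ := h.cons hp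
    obtain ⟨k, k', h1, h2, h3⟩ := hR x y ⟨hpx, hrest.lt, hvar.1⟩ hvar
    -- Only digits stand strictly between `p` and `x`, and cuts avoid digits, so the count does not
    -- change there.
    have hik : i = k := by
      refine hi.unique fun a => (h2 a).trans ⟨fun ha => ?_, fun ha => ha.trans_lt hpx⟩
      by_contra hpa
      obtain ⟨c, hc, hc'⟩ := hbits _ (not_le.1 hpa) ha
      obtain ⟨c1, hc1, hc1'⟩ := hd a
      rw [hc, Option.mem_def, Option.some_inj] at hc1
      subst hc1
      simp [hc'] at hc1'
    subst hik
    exact ⟨k', h1, ih hrest hvar.nonBit h3 fun z w hz => hR z w ⟨hpx.trans hz.1, hz.2⟩⟩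

/-- Edges never go down, so each level `a` is crossed at most once, and cut `a` is put at the letter
that crosses it. It is put at `p` if the path starts above level `a`, and at `e` if the path never
rises above it. -/
theorem WordAt.cuts_of_path (hR : ∀ x a b, R x a b → a ≤ b) {l : List ℕ} {j : Fin (m + 1)} :
    ∀ {p : ℕ} {i : Fin (m + 1)}, WordAt s p l e → NonBit s p → Path R l i j →
      ∃ c : Fin m → ℕ, (∀ a, NonBit s (c a)) ∧ (∀ a b, a < b → c a ≤ c b) ∧
        Below (fun a => c a ≤ p) i ∧ Below (fun a => c a < e) j ∧
        ∀ x y, IsLetter s p e x → VarAt s x y →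
          ∃ k k', R y k k' ∧ Below (fun a => c a < x) k ∧ Below (fun a => c a ≤ x) k' := by
  induction l with
  | nil =>
    intro p i h hp hij
    have hend := h.getElem?_end
    obtain ⟨t, -, he⟩ := h
    have he' : e = p + 1 := by simpa using he
    subst he'
    obtain rfl : i = j := hij
    refine ⟨fun a => if (a : ℕ) < i then p else p + 1, fun a => ?_, fun a b hab => ?_,
      fun a => ?_, fun a => ?_, fun x y hx => ?_⟩
    · dsimp only
      split_ifs
      · exact hp
      · exact ⟨_, hend, rfl⟩
    · rw [Fin.lt_def] at hab
      dsimp only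
      split_ifs <;> omega
    · dsimp only
      split_ifs <;> omega
    · dsimp only
      split_ifs <;> omega
    · have := hx.1
      have := hx.2.1
      omega
  | cons y l ih =>
    rintro p i h hp ⟨k, hik, hkj⟩
    obtain ⟨x, hpx, hbits, hvar, hrest⟩ := h.cons hp
    obtain ⟨c, hc, hmono, hk, hj, hlet⟩ := ih hrest hvar.nonBit hkj
    have hle : (i : ℕ) ≤ k := hR _ _ _ hik
    have hxe := hrest.lt
    -- The cuts for the rest of the path are corrected as follows: those below `i` go to `p`, and
    -- those from `i` up to `k`, which the first letter crosses, go to `x`. All of them were at or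
    -- before `x` and remain so, hence comparisons beyond `x` are not affected.
    have key (z : ℕ) (hz : x < z) (a : Fin m) :
        ((if (a : ℕ) < i then p else max (c a) x) < z ↔ c a < z) ∧
        ((if (a : ℕ) < i then p else max (c a) x) ≤ z ↔ c a ≤ z) := by
      have := hk a
      split_ifs <;> omega
    refine ⟨fun a => if (a : ℕ) < i then p else max (c a) x, fun a => ?_, fun a b hab => ?_,
      fun a => ?_, fun a => (hj a).trans (key e hxe a).1.symm, fun z w hz hw => ?_⟩
    · dsimp only
      split_ifs
      · exact hp
      · rcases max_choice (c a) x with h | h <;> rw [h]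
        · exact hc a
        · exact hvar.nonBit
    · have := hmono a b hab
      rw [Fin.lt_def] at hab
      dsimp only
      split_ifs <;> omega
    · dsimp only
      split_ifs <;> omega
    · rcases lt_trichotomy z x with hzx | rfl | hzx
      · obtain ⟨a, ha, ha'⟩ := hbits z hz.1 hzx
        rw [hz.2.2, Option.mem_def, Option.some_inj] at ha
        subst ha
        simp [Sym.isBit] at ha'
      · obtain rfl := hvar.unique hw
        refine ⟨i, k, hik, fun a => ?_, fun a => ?_⟩
        · dsimp only
          split_ifs <;> omega
        · have := hk a
          dsimp only at this ⊢
          split_ifs <;> omega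
      · obtain ⟨k1, k2, h1, h2, h3⟩ := hlet z w ⟨hzx, hz.2⟩ hw
        exact ⟨k1, k2, h1, fun a => (h2 a).trans (key z hzx a).1.symm,
          fun a => (h3 a).trans (key z hzx a).2.symm⟩

end Cuts

theorem IsWord.nonBit {s : List Sym} {b e : ℕ} (h : IsWord s b e) : NonBit s b := by
  obtain ⟨a, ha, ha'⟩ := h.1
  refine ⟨a, ha, ?_⟩
  cases a <;> simp_all [Sym.isEnd, Sym.isBit]

/-- The words on the side `sd` of the identity that is written in `s` are those in `L`. -/
structure HasWords (s : List Sym) (sd : Bool) (L : List (List ℕ)) : Prop where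
  exists_mem : ∀ b e, IsWord s b e → OnSide s sd e → ∃ l ∈ L, WordAt s b l e
  exists_wordAt : ∀ l ∈ L, ∃ b e, IsWord s b e ∧ OnSide s sd e ∧ WordAt s b l e

/-- In one direction, the cuts of a given path are imitated and turned into a path through the same
edges. In the other, the hypothesis is applied to the smallest graph that contains the path
described by the cuts; every edge of the new path then comes from an occurrence in the given word,
which is the required counterpart. -/
theorem included_iff {s : List Sym} {m : ℕ} {sd sd' : Bool} {L L' : List (List ℕ)}
    (hL : HasWords s sd L) (hL' : HasWords s sd' L') :
    Included s m sd sd' ↔ ∀ l ∈ L, ∀ R : ℕ → Fin (m + 1) → Fin (m + 1) → Prop,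
      (∀ x a b, R x a b → a ≤ b) → ∀ i j, Path R l i j → ∃ l' ∈ L', Path R l' i j := by
  constructor
  · intro h l hl R hR i j hpath
    obtain ⟨b, e, hw, hs, hwat⟩ := hL.exists_wordAt l hl
    obtain ⟨c, hc, hmono, hi, hj, hlet⟩ := hwat.cuts_of_path hR hw.nonBit hpath
    obtain ⟨b', e', d, hw', hs', hd, hends, himit⟩ := h b e c hw hs hc hmono
    obtain ⟨l', hl', hwat'⟩ := hL'.exists_mem b' e' hw' hs'
    refine ⟨l', hl', hwat'.path_of_cuts hd (fun a => (hj a).trans (hends a).2) hw'.nonBit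
      (fun a => (hi a).trans (hends a).1) fun x y hx hy => ?_⟩
    obtain ⟨z, hz, hsame, hcd⟩ := himit x hx
    obtain ⟨y', hy'⟩ := hwat.exists_varAt hw.nonBit hz
    obtain rfl := (hy.sameVar_iff hy').1 hsame
    obtain ⟨k, k', h1, h2, h3⟩ := hlet z y hz hy'
    exact ⟨k, k', h1, fun a => (h2 a).trans (hcd a).1, fun a => (h3 a).trans (hcd a).2⟩
  · intro h b e c hw hs hc hmono
    obtain ⟨l, hl, hwat⟩ := hL.exists_mem b e hw hs
    have hle (z : ℕ) : ∃ k, Below (fun a => c a ≤ z) k :=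
      exists_below _ fun a b hab hb => (hmono a b hab).trans hb
    have hlt (z : ℕ) : ∃ k, Below (fun a => c a < z) k :=
      exists_below _ fun a b hab hb => (hmono a b hab).trans_lt hb
    obtain ⟨i, hi⟩ := hle b
    obtain ⟨j, hj⟩ := hlt e
    -- The relation consists of the edges of the path that `c` describes, and of no others.
    obtain ⟨l', hl', hpath⟩ := h l hl (fun y k k' => ∃ z, IsLetter s b e z ∧ VarAt s z y ∧
        Below (fun a => c a < z) k ∧ Below (fun a => c a ≤ z) k')
      (fun x k k' ⟨z, _, _, h1, h2⟩ => h1.le h2 fun a ha => le_of_lt ha) i j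
      (hwat.path_of_cuts hc hj hw.nonBit hi fun x y hx hy => by
        obtain ⟨k, hk⟩ := hlt x
        obtain ⟨k', hk'⟩ := hle x
        exact ⟨k, k', ⟨x, hx, hy, hk, hk'⟩, hk, hk'⟩)
    obtain ⟨b', e', hw', hs', hwat'⟩ := hL'.exists_wordAt l' hl'
    obtain ⟨d, hd, -, hi', hj', hlet⟩ := hwat'.cuts_of_path
      (fun x k k' ⟨z, _, _, h1, h2⟩ => h1.le h2 fun a ha => le_of_lt ha) hw'.nonBit hpath
    refine ⟨b', e', d, hw', hs', hd, fun a => ⟨(hi a).symm.trans (hi' a),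
      (hj a).symm.trans (hj' a)⟩, fun x hx => ?_⟩
    obtain ⟨y, hy⟩ := hwat'.exists_varAt hw'.nonBit hx
    obtain ⟨k, k', ⟨z, hz, hzy, h1, h2⟩, h3, h4⟩ := hlet x y hx hy
    exact ⟨z, hz, (hy.sameVar_iff hzy).2 rfl, fun a => ⟨(h1 a).symm.trans (h3 a),
      (h2 a).symm.trans (h4 a)⟩⟩

/-! ### The two sides of a written identity -/

/-- The words in `L` and the end of a side are written in `s` after the position `p`, and the side
ends at the position `q`. -/
def SideAt (s : List Sym) (p : ℕ) (L : List Word) (q : ℕ) : Prop :=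
  ∃ t, s.drop (p + 1) = L.flatMap writeWord ++ .endSide :: t ∧
    q = p + 1 + (L.flatMap writeWord).length

section SideAt

variable {s : List Sym} {q : ℕ}

theorem SideAt.lt {p : ℕ} {L : List Word} (h : SideAt s p L q) : p < q := by
  obtain ⟨t, -, rfl⟩ := h
  omega

theorem SideAt.getElem?_end {p : ℕ} {L : List Word} (h : SideAt s p L q) :
    s[q]? = some .endSide := by
  obtain ⟨t, h1, rfl⟩ := h
  exact getElem?_add_length_of_drop_eq h1

theorem SideAt.cons {p : ℕ} {w : Word} {L : List Word} (h : SideAt s p (w :: L) q) :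
    ∃ e, WordAt s p (Word.letters w) e ∧ SideAt s e L q := by
  obtain ⟨t, h1, rfl⟩ := h
  rw [List.flatMap_cons, writeWord, List.append_assoc, List.append_assoc,
    List.singleton_append] at h1
  refine ⟨_, ⟨_, h1, rfl⟩, t, ?_, ?_⟩
  · rw [Nat.add_assoc, ← List.drop_drop, h1, ← List.drop_drop, List.drop_left]
    rfl
  · simp [writeWord]
    omega

/-- Written words contain no end marks inside, so a segment that begins where the first word begins
has to end with it, and every other segment lies in the rest of the side. -/
theorem SideAt.exists_mem {L : List Word} : ∀ {p : ℕ}, SideAt s p L q →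
    ∀ b e, IsWord s b e → p ≤ b → e < q → ∃ w ∈ L, WordAt s b (Word.letters w) e := by
  induction L with
  | nil =>
    rintro p ⟨t, -, hq⟩ b e hw hb he
    have := hw.2.2.1
    simp at hq
    omega
  | cons w L ih =>
    intro p h b e hw hb he
    obtain ⟨e', h1, h2⟩ := h.cons
    rcases hb.eq_or_lt with rfl | hb
    · rcases lt_trichotomy e e' with hee | rfl | hee
      · exact absurd ⟨_, hw.2.1, rfl⟩ (h1.not_isEnd hw.2.2.1 hee)
      · exact ⟨w, List.mem_cons_self, h1⟩
      · exact absurd ⟨_, h1.getElem?_end, rfl⟩ (hw.2.2.2 e' h1.lt hee)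
    · have hb' : e' ≤ b := by
        by_contra hlt
        exact h1.not_isEnd hb (not_le.1 hlt) hw.1
      obtain ⟨w', hw', h3⟩ := ih h2 b e hw hb' he
      exact ⟨w', List.mem_cons_of_mem _ hw', h3⟩

theorem SideAt.exists_wordAt {L : List Word} : ∀ {p : ℕ}, SideAt s p L q →
    (∃ a ∈ s[p]?, a.isEnd = true) →
    ∀ w ∈ L, ∃ b e, IsWord s b e ∧ p ≤ b ∧ e < q ∧ WordAt s b (Word.letters w) e := by
  induction L with
  | nil => simp
  | cons w L ih =>
    intro p h hp w' hw'
    obtain ⟨e', h1, h2⟩ := h.cons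
    rcases List.mem_cons.1 hw' with rfl | hw'
    · exact ⟨p, e', h1.isWord hp, le_rfl, h2.lt, h1⟩
    · obtain ⟨b, e, h3, h4, h5⟩ := ih h2 ⟨_, h1.getElem?_end, rfl⟩ w' hw'
      exact ⟨b, e, h3, h1.lt.le.trans h4, h5⟩

theorem SideAt.ne_endSide {L : List Word} : ∀ {p : ℕ}, SideAt s p L q →
    ∀ z, p < z → z < q → s[z]? ≠ some .endSide := by
  induction L with
  | nil =>
    rintro p ⟨t, -, hq⟩ z hz hz'
    simp at hq
    omega
  | cons w L ih =>
    intro p h z hz hz' hs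
    obtain ⟨e', h1, h2⟩ := h.cons
    rcases lt_trichotomy z e' with hze | rfl | hze
    · exact h1.not_isEnd hz hze ⟨_, hs, rfl⟩
    · rw [h1.getElem?_end] at hs
      simp at hs
    · exact ih h2 z hze hz' hs

end SideAt

theorem Instance.exists_sideAt (E : Instance) :
    ∃ q q', SideAt (.endWord :: E.write) 0 E.lhs q ∧ SideAt (.endWord :: E.write) q E.rhs q' ∧
      (Sym.endWord :: E.write).length = q' + 1 := by
  have h : E.write =
      E.lhs.flatMap writeWord ++ .endSide :: (E.rhs.flatMap writeWord ++ [.endSide]) := by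
    simp [Instance.write, writeSide]
  refine ⟨_, _, ⟨_, by rw [List.drop_succ_cons, List.drop_zero, h], rfl⟩,
    ⟨[], ?_, rfl⟩, ?_⟩
  · rw [h, List.drop_succ_cons, Nat.zero_add, Nat.add_comm, ← List.drop_drop, List.drop_left]
    rfl
  · simp [h]
    omega

theorem Instance.hasWords_lhs (E : Instance) :
    HasWords (.endWord :: E.write) false (E.lhs.map Word.letters) := by
  obtain ⟨q, q', h1, h2, h3⟩ := E.exists_sideAt
  -- Position 0 holds the guard `.endWord`, which is not a side mark.
  have hside (e : ℕ) (he : e < q) : OnSide (.endWord :: E.write) false e := by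
    refine ⟨nofun, ?_⟩
    rintro ⟨z, hz, hz'⟩
    rcases Nat.eq_zero_or_pos z with rfl | h0
    · simp at hz'
    · exact absurd hz' (h1.ne_endSide z h0 (hz.trans_lt he))
  refine ⟨fun b e hw hs => ?_, fun l hl => ?_⟩
  · have he : e < q := by
      by_contra he
      exact absurd (hs.2 ⟨q, not_lt.1 he, h1.getElem?_end⟩) (by decide)
    obtain ⟨w, hw', h4⟩ := h1.exists_mem b e hw (Nat.zero_le _) he
    exact ⟨_, List.mem_map_of_mem hw', h4⟩
  · obtain ⟨w, hw, rfl⟩ := List.mem_map.1 hl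
    obtain ⟨b, e, h4, -, h5, h6⟩ := h1.exists_wordAt ⟨.endWord, rfl, rfl⟩ w hw
    exact ⟨b, e, h4, hside e h5, h6⟩

theorem Instance.hasWords_rhs (E : Instance) :
    HasWords (.endWord :: E.write) true (E.rhs.map Word.letters) := by
  obtain ⟨q, q', h1, h2, h3⟩ := E.exists_sideAt
  refine ⟨fun b e hw hs => ?_, fun l hl => ?_⟩
  · obtain ⟨z, hz, hz'⟩ := hs.1 rfl
    have hqe : q ≤ e := by
      by_contra he
      rcases Nat.eq_zero_or_pos z with rfl | h0
      · simp at hz'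
      · exact h1.ne_endSide z h0 (hz.trans_lt (not_le.1 he)) hz'
    have hqe' : q < e := by
      refine hqe.lt_of_ne ?_
      rintro rfl
      have := hw.2.1
      rw [h1.getElem?_end] at this
      simp at this
    -- A word has no end mark inside, so it cannot straddle the mark at `q`. This mark also serves
    -- as the beginning of the first word on the right.
    have hqb : q ≤ b := by
      by_contra hb
      exact hw.2.2.2 q (not_le.1 hb) hqe' ⟨_, h1.getElem?_end, rfl⟩
    have heq : e < q' := by
      have := lt_length_of_mem hw.2.1
      refine (by omega : e ≤ q').lt_of_ne ?_
      rintro rfl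
      have := hw.2.1
      rw [h2.getElem?_end] at this
      simp at this
    obtain ⟨w, hw', h4⟩ := h2.exists_mem b e hw hqb heq
    exact ⟨_, List.mem_map_of_mem hw', h4⟩
  · obtain ⟨w, hw, rfl⟩ := List.mem_map.1 hl
    obtain ⟨b, e, h4, h5, -, h6⟩ := h2.exists_wordAt ⟨_, h1.getElem?_end, rfl⟩ w hw
    exact ⟨b, e, h4, ⟨fun _ => ⟨q, h5.trans h4.2.2.1.le, h1.getElem?_end⟩, fun _ => rfl⟩, h6⟩

/-! ### Identities of the semiring of upper triangular Boolean matrices -/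

section Matrices

namespace BoolSR

theorem add_eq_one : ∀ a b : BoolSR, a + b = 1 ↔ a = 1 ∨ b = 1 := by decide

theorem mul_eq_one : ∀ a b : BoolSR, a * b = 1 ↔ a = 1 ∧ b = 1 := by decide

theorem zero_ne_one : (0 : BoolSR) ≠ 1 := by decide

theorem eq_of_eq_one_iff : ∀ a b : BoolSR, (a = 1 ↔ b = 1) → a = b := by decide

theorem sum_eq_one {ι : Type} (t : Finset ι) (f : ι → BoolSR) :
    ∑ i ∈ t, f i = 1 ↔ ∃ i ∈ t, f i = 1 := by
  classical
  induction t using Finset.induction_on with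
  | empty => simp
  | insert a t ha ih => rw [Finset.sum_insert ha, add_eq_one, ih, Finset.exists_mem_insert]

end BoolSR

variable {n : ℕ}

/-- A Boolean matrix product has entry 1 iff some intermediate vertex joins the two factors, which
is how paths are composed. -/
theorem lift_apply_eq_one (φ : ℕ → T n) (w : Word) : ∀ i j : Fin n,
    (FreeSemigroup.lift φ w).1 i j = 1 ↔
      Path (fun x i j => (φ x).1 i j = 1) (Word.letters w) i j := by
  induction w using FreeSemigroup.recOnMul with
  | ih1 x =>
    intro i j
    rw [FreeSemigroup.lift_of]
    simp [Word.letters, FreeSemigroup.of, Path]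
  | ih2 x y _ ih =>
    intro i j
    have h : Word.letters (FreeSemigroup.of x * y) = x :: Word.letters y := rfl
    have h' : (FreeSemigroup.lift φ (FreeSemigroup.of x * y)).1 =
        (φ x).1 * (FreeSemigroup.lift φ y).1 := by
      rw [FreeSemigroup.lift_of_mul]
      rfl
    rw [h, h', Matrix.mul_apply, BoolSR.sum_eq_one, Path]
    simp only [Finset.mem_univ, true_and, BoolSR.mul_eq_one, ih]

theorem value_apply_eq_one (φ : ℕ → T n) (W : Poly) (i j : Fin n) :
    (W.value φ).1 i j = 1 ↔
      ∃ w ∈ W.1, Path (fun x i j => (φ x).1 i j = 1) (Word.letters w) i j := by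
  have h : (W.value φ).1 = ∑ w ∈ W.1, (FreeSemigroup.lift φ w).1 :=
    map_sum (T n).subtype _ _
  rw [h, Matrix.sum_apply, BoolSR.sum_eq_one]
  simp only [lift_apply_eq_one]

/-- Each path that is labelled by a word from `W` in a graph with increasing edges can be replaced
by a path that is labelled by a word from `W'`. -/
def PathIncluded (n : ℕ) (W W' : Poly) : Prop :=
  ∀ w ∈ W.1, ∀ R : ℕ → Fin n → Fin n → Prop, (∀ x a b, R x a b → a ≤ b) →
    ∀ i j, Path R (Word.letters w) i j → ∃ w' ∈ W'.1, Path R (Word.letters w') i j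

theorem Holds.symm {W W' : Poly} (h : Holds (T n) W W') : Holds (T n) W' W :=
  fun φ => (h φ).symm

/-- Edge sets without descending edges are exactly the patterns of ones of upper triangular
matrices, so every such family of graphs arises from a substitution. -/
theorem Holds.pathIncluded {W W' : Poly} (h : Holds (T n) W W') : PathIncluded n W W' := by
  classical
  intro w hw R hR i j hpath
  set φ : ℕ → T n := fun x => ⟨Matrix.of fun i j => if R x i j then 1 else 0, fun i j hij => by
    have : ¬ R x i j := fun hx => (hR x i j hx).not_gt hij
    simp [this]⟩ with hφ
  have hRφ : (fun x i j => (φ x).1 i j = 1) = R := by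
    funext x i j
    by_cases hx : R x i j
    · simp [hφ, hx]
    · simp [hφ, hx]
  rw [← hRφ] at hpath ⊢
  rw [← value_apply_eq_one, ← h φ, value_apply_eq_one]
  exact ⟨w, hw, hpath⟩

theorem holds_iff (W W' : Poly) :
    Holds (T n) W W' ↔ PathIncluded n W W' ∧ PathIncluded n W' W := by
  refine ⟨fun h => ⟨h.pathIncluded, h.symm.pathIncluded⟩, fun ⟨h, h'⟩ φ => ?_⟩
  have hmono : ∀ x (a b : Fin n), (φ x).1 a b = 1 → a ≤ b := by
    intro x a b hab
    by_contra hlt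
    have h0 : (φ x).1 a b = 0 := (φ x).2 (not_le.1 hlt)
    rw [h0] at hab
    exact BoolSR.zero_ne_one hab
  refine Subtype.ext (Matrix.ext fun i j => BoolSR.eq_of_eq_one_iff _ _ ?_)
  rw [value_apply_eq_one, value_apply_eq_one]
  exact ⟨fun ⟨w, hw, hp⟩ => h w hw _ hmono i j hp, fun ⟨w, hw, hp⟩ => h' w hw _ hmono i j hp⟩

end Matrices

/-! ### The formula for an identity and its machine -/

theorem Instance.eval_included_iff_holds (m : ℕ) (E : Instance) :
    (Fml.and (Fml.included m false true) (Fml.included m true false)).Eval (.endWord :: E.write)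
      (fun _ => 0) ↔ Holds (T (m + 1)) E.left E.right := by
  rw [Fml.eval_and, Fml.eval_included fun _ => Nat.zero_le _,
    Fml.eval_included fun _ => Nat.zero_le _, included_iff E.hasWords_lhs E.hasWords_rhs,
    included_iff E.hasWords_rhs E.hasWords_lhs, holds_iff]
  simp [PathIncluded, Instance.left, Instance.right]

theorem exists_machine_answer (n : ℕ) :
    ∃ (M : Turing.TM2ComputableAux Sym Bool) (p : Polynomial ℕ), ∀ (E : Instance) (t : ℕ),
      p.eval E.write.length ≤ t → AnswersWithin M E.write (answer n E) t := by
  have hanswer (E : Instance) : answer n E = true ↔ Holds (T n) E.left E.right :=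
    @decide_eq_true_iff _ (Classical.propDecidable _)
  cases n with
  | zero =>
    -- `T 0` has a single element, so the answer is always YES; cuts are available only for at least
    -- one vertex.
    obtain ⟨M, p, h⟩ := Fml.exists_machine (φ := (Fml.tru : Fml (Var 0))) trivial
    refine ⟨M, p, fun E => h _ _ ((hanswer E).trans ?_)⟩
    have h1 : Holds (T 0) E.left E.right :=
      fun φ => Subtype.ext (Matrix.ext fun i => i.elim0)
    simp [h1, Fml.tru]
  | succ m =>
    obtain ⟨M, p, h⟩ := Fml.exists_machine
      (φ := Fml.and (Fml.included m false true) (Fml.included m true false))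
      ⟨Fml.proper_included, Fml.proper_included⟩
    exact ⟨M, p, fun E => h _ _ ((hanswer E).trans (E.eval_included_iff_holds m).symm)⟩

/-! ### The length of the input -/

theorem length_writeVar_le (i : ℕ) : (writeVar i).length ≤ i + 1 := by
  have : i.size ≤ i := Nat.size_le.2 Nat.lt_two_pow_self
  simpa [writeVar, Nat.size_eq_bits_len] using this

theorem length_writeWord_le {N : ℕ} (w : Word) (h : ∀ i ∈ Word.letters w, i < N) :
    (writeWord w).length ≤ (N + 1) * w.length := by
  have key : ∀ l : List ℕ, (∀ i ∈ l, i < N) → (l.flatMap writeVar).length ≤ N * l.length := by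
    intro l
    induction l with
    | nil => simp
    | cons i l ih =>
      intro hl
      rw [List.forall_mem_cons] at hl
      have h1 := ih hl.2
      have h2 := length_writeVar_le i
      rw [List.flatMap_cons, List.length_append, List.length_cons, Nat.mul_succ]
      omega
  have h1 := key _ h
  have h2 : (Word.letters w).length = w.length := rfl
  -- Words are nonempty, so the additional 1 in the factor `N + 1` pays for the end mark.
  have h3 : 1 ≤ w.length := Nat.le_add_left _ _
  rw [writeWord, List.length_append, List.length_singleton, Nat.succ_mul]
  rw [h2] at h1
  omega

theorem length_writeSide_le {N : ℕ} (L : List Word)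
    (h : ∀ w ∈ L, ∀ i ∈ Word.letters w, i < N) :
    (writeSide L).length ≤ (N + 1) * (L.map FreeSemigroup.length).sum + 1 := by
  have key : (L.flatMap writeWord).length ≤ (N + 1) * (L.map FreeSemigroup.length).sum := by
    induction L with
    | nil => simp
    | cons w L ih =>
      rw [List.forall_mem_cons] at h
      have h1 := length_writeWord_le w h.1
      have h2 := ih h.2
      rw [List.flatMap_cons, List.length_append, List.map_cons, List.sum_cons, Nat.mul_add]
      omega
  rw [writeSide, List.length_append, List.length_singleton]
  omega

theorem Instance.length_write_le (E : Instance) (h : ∀ i, E.Occurs i → i < E.size) :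
    E.write.length ≤ (E.size + 1) * E.size + 2 := by
  have h1 := length_writeSide_le E.lhs fun w hw i hi =>
    h i ⟨w, List.mem_append_left _ hw, hi⟩
  have h2 := length_writeSide_le E.rhs fun w hw i hi =>
    h i ⟨w, List.mem_append_right _ hw, hi⟩
  rw [Instance.write, List.length_append]
  have h3 : (E.size + 1) * E.size = (E.size + 1) * (E.lhs.map FreeSemigroup.length).sum +
      (E.size + 1) * (E.rhs.map FreeSemigroup.length).sum := by
    rw [← Nat.mul_add]
    rfl
  omega

theorem eval_le_eval (p : Polynomial ℕ) {a b : ℕ} (h : a ≤ b) : p.eval a ≤ p.eval b := by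
  rw [Polynomial.eval_eq_sum, Polynomial.eval_eq_sum, Polynomial.sum, Polynomial.sum]
  gcongr

end CheckId

theorem mainTheorem10 (n : ℕ) :
    ∃ (M : Turing.TM2ComputableAux CheckId.Sym Bool) (p q : Polynomial ℕ),
      ∀ E : CheckId.Instance,
        CheckId.AnswersWithin M E.write (CheckId.answer n E) (p.eval E.write.length) ∧
        ((∀ i, E.Occurs i → i < E.size) →
          CheckId.AnswersWithin M E.write (CheckId.answer n E) (q.eval E.size)) := by
  obtain ⟨M, p, h⟩ := CheckId.exists_machine_answer n
  -- The inner polynomial is the bound for the input length from `Instance.length_write_le`; `p` is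
  -- monotone because its coefficients are natural numbers.
  refine ⟨M, p, p.comp ((Polynomial.X + 1) * Polynomial.X + 2), fun E =>
    ⟨h E _ le_rfl, fun hE => h E _ ?_⟩⟩
  have := CheckId.eval_le_eval p (E.length_write_le hE)
  simpa using this
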